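/- Let $(M,g)$ be a smooth Riemannian manifold (without boundary) of dimension $n\ge 4$, and let $[g]=\{e^{2f}g : f\in C^\infty(M)\}$ be its conformal class. For a metric $h$ with $(0,4)$ curvature tensor $R$, Ricci tensor $\mathrm{Ric}$ and scalar curvature $s$, let $S=\frac1{n-2}\bigl(\mathrm{Ric}-\frac{s}{2(n-1)}h\bigr)$ be the Schouten tensor and let $W$ be the Weyl tensor, defined by $R=W+S\owedge h$, where $(\alpha\owedge\beta)_{ijkl}=\alpha_{ik}\beta_{jl}+\beta_{ik}\alpha_{jl}-\alpha_{il}\beta_{jk}-\alpha_{jk}\beta_{il}$. At a point $p$, regard $W$ as the endomorphism $W_p$ of $\Lambda^2(T_pM)$ determined by $\langle W_p(x\wedge y),z\wedge t\rangle=W(x,y,z,t)$, where $\langle x\wedge y,z\wedge t\rangle=h(x,z)h(y,t)-h(x,t)h(y,z)$. For $v\in T_pM$ put $v\wedge v^\perp=\{v\wedge w : w\in T_pM,\ h(v,w)=0\}$; a bivector is called simple if it has the form $x\wedge y$ with $x,y\in T_pM$. Assume that some metric $\tilde g\in[g]$ admits a smooth vector field $X$ that is parallel for the Levi-Civita connection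 of $\tilde g$ (that is, $\tilde\nabla X=0$) and does not vanish identically on any connected component of $M$ (for connected $M$: $X\neq 0$). Then for every $p\in M$ there is a non-zero vector $v\in T_pM$ such that, for every metric $h\in[g]$, the Weyl operator $W_p$ of $h$ satisfies $$W_p(v\wedge v^\perp)\subset v\wedge v^\perp .$$ In particular, for every $p\in M$ and every metric $h\in[g]$, the Weyl operator $W_p$ of $h$ has at least $n-1$ linearly independent eigenvectors which are simple bivectors. -/

import Mathlib

open scoped Manifold ContDiff

noncomputable section

namespace ConformalWeyl

/-! ### Curvature of a metric given by its matrix of components on a domain of `ℝⁿ`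

`G y i j = g_{ij}(y)`, and `(G y)⁻¹ i j = g^{ij}(y)`. -/

section Local

variable {n : ℕ}

/-- The partial derivative `∂_i f (y)`. -/
def partialDeriv (i : Fin n) (f : EuclideanSpace ℝ (Fin n) → ℝ)
    (y : EuclideanSpace ℝ (Fin n)) : ℝ :=
  fderiv ℝ f y (EuclideanSpace.single i 1)

variable (G : EuclideanSpace ℝ (Fin n) → Matrix (Fin n) (Fin n) ℝ)

/-- The Christoffel symbols of the Levi-Civita connection: `christoffel G k i j y = Γ^k_{ij}(y)`,
so that `∇_{∂_i} ∂_j = ∑_k Γ^k_{ij} ∂_k`. -/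
def christoffel (k i j : Fin n) (y : EuclideanSpace ℝ (Fin n)) : ℝ :=
  (1 / 2) * ∑ l, (G y)⁻¹ k l *
    (partialDeriv i (fun z => G z j l) y + partialDeriv j (fun z => G z i l) y
      - partialDeriv l (fun z => G z i j) y)

/-- The `m`-th component of
`R(∂_i, ∂_j) ∂_l = ∇_{∂_i} ∇_{∂_j} ∂_l - ∇_{∂_j} ∇_{∂_i} ∂_l`. -/
def curvatureUp (m i j l : Fin n) (y : EuclideanSpace ℝ (Fin n)) : ℝ :=
  partialDeriv i (christoffel G m j l) y - partialDeriv j (christoffel G m i l) y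
    + ∑ s, (christoffel G m i s y * christoffel G s j l y
      - christoffel G m j s y * christoffel G s i l y)

/-- The `(0,4)` curvature tensor `R_{ijkl} = g(R(∂_i, ∂_j) ∂_l, ∂_k)`; with this convention
`R_{ijij}` is positive on round spheres. -/
def riemann (i j k l : Fin n) (y : EuclideanSpace ℝ (Fin n)) : ℝ :=
  ∑ m, G y k m * curvatureUp G m i j l y

/-- The Ricci tensor `Ric_{ik} = ∑ g^{jl} R_{ijkl}`. -/
def ricci (i k : Fin n) (y : EuclideanSpace ℝ (Fin n)) : ℝ :=
  ∑ j, ∑ l, (G y)⁻¹ j l * riemann G i j k l y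

/-- The scalar curvature `s = ∑ g^{ik} Ric_{ik}`. -/
def scalarCurvature (y : EuclideanSpace ℝ (Fin n)) : ℝ :=
  ∑ i, ∑ k, (G y)⁻¹ i k * ricci G i k y

/-- The Schouten tensor `S = (Ric - s g / (2 (n - 1))) / (n - 2)`. -/
def schouten (i k : Fin n) (y : EuclideanSpace ℝ (Fin n)) : ℝ :=
  (1 / ((n : ℝ) - 2)) *
    (ricci G i k y - 1 / (2 * ((n : ℝ) - 1)) * scalarCurvature G y * G y i k)

/-- The Kulkarni-Nomizu product of two symmetric `2`-tensors. -/
def kulkarniNomizu (a b : Fin n → Fin n → ℝ) (i j k l : Fin n) : ℝ :=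
  a i k * b j l + b i k * a j l - a i l * b j k - a j k * b i l

/-- The `(0,4)` Weyl tensor, defined by the decomposition `R = W + S ∧ g` with the
Kulkarni-Nomizu product. -/
def weyl (i j k l : Fin n) (y : EuclideanSpace ℝ (Fin n)) : ℝ :=
  riemann G i j k l y
    - kulkarniNomizu (fun a b => schouten G a b y) (fun a b => G y a b) i j k l

end Local

section Global

variable {n : ℕ} {M : Type*} [TopologicalSpace M] [ChartedSpace (EuclideanSpace ℝ (Fin n)) M]

/-- Smooth vector fields on `M`. -/
def IsSmoothVectorField [IsManifold (𝓡 n) ∞ M] (X : ∀ p : M, TangentSpace (𝓡 n) p) : Prop :=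
  ContMDiff (𝓡 n) (𝓡 n).tangent ∞
    (fun p => (⟨p, X p⟩ : TangentBundle (𝓡 n) M))

variable (n M) in
/-- Smooth Riemannian metrics on the `n`-dimensional manifold `M`. -/
abbrev SmoothMetric [IsManifold (𝓡 n) ∞ M] : Type _ :=
  Bundle.ContMDiffRiemannianMetric (𝓡 n) ∞ (EuclideanSpace ℝ (Fin n))
    (TangentSpace (𝓡 n) : M → Type _)

variable [IsManifold (𝓡 n) ∞ M]

/-- `g'` belongs to the conformal class `[g]`: `g' = e^{2f} g` for a smooth function `f`. -/
def IsConformalTo (g g' : SmoothMetric n M) : Prop :=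
  ∃ f : M → ℝ, ContMDiff (𝓡 n) 𝓘(ℝ, ℝ) ∞ f ∧
    ∀ (p : M) (v w : TangentSpace (𝓡 n) p),
      g'.inner p v w = Real.exp (2 * f p) * g.inner p v w

/-- The coordinate vector field `∂_i` of the preferred chart around `p`, at the point with
coordinates `y`. -/
def coordField (p : M) (i : Fin n) (y : EuclideanSpace ℝ (Fin n)) :
    TangentSpace (𝓡 n) ((extChartAt (𝓡 n) p).symm y) :=
  mfderiv 𝓘(ℝ, EuclideanSpace ℝ (Fin n)) (𝓡 n) (extChartAt (𝓡 n) p).symm y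
    (EuclideanSpace.single i 1 : EuclideanSpace ℝ (Fin n))

/-- The components `g_{ij} = g(∂_i, ∂_j)` in the preferred chart around `p`. -/
def metricInChart (g : SmoothMetric n M) (p : M) (y : EuclideanSpace ℝ (Fin n)) :
    Matrix (Fin n) (Fin n) ℝ :=
  Matrix.of fun i j =>
    g.inner ((extChartAt (𝓡 n) p).symm y) (coordField p i y) (coordField p j y)

/-- The component `X^k` of a vector field in the preferred chart around `p`. -/
def fieldInChart (X : ∀ q : M, TangentSpace (𝓡 n) q) (p : M) (k : Fin n)
    (y : EuclideanSpace ℝ (Fin n)) : ℝ :=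
  (EuclideanSpace.proj k : EuclideanSpace ℝ (Fin n) →L[ℝ] ℝ)
    (mfderiv (𝓡 n) 𝓘(ℝ, EuclideanSpace ℝ (Fin n)) (extChartAt (𝓡 n) p)
      ((extChartAt (𝓡 n) p).symm y) (X ((extChartAt (𝓡 n) p).symm y)))

/-- `X` is parallel for the Levi-Civita connection of `g`, that is `∇ X = 0`: in the chart around
every point, `∂_i X^k + ∑_j Γ^k_{ij} X^j = 0` on the whole chart domain. -/
def IsParallel (g : SmoothMetric n M) (X : ∀ p : M, TangentSpace (𝓡 n) p) : Prop :=
  ∀ p : M, ∀ y ∈ (extChartAt (𝓡 n) p).target, ∀ i k : Fin n,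
    partialDeriv i (fieldInChart X p k) y
      + ∑ j, christoffel (metricInChart g p) k i j y * fieldInChart X p j y = 0

/-- The metric `g` admits a parallel vector field. The zero field is excluded: the field must not
vanish identically on any connected component of `M` (for connected `M` this says that it is
not the zero field). -/
def AdmitsParallelField (g : SmoothMetric n M) : Prop :=
  ∃ X : ∀ p : M, TangentSpace (𝓡 n) p, IsSmoothVectorField X ∧ IsParallel g X ∧
    ∀ p : M, ∃ q ∈ connectedComponent p, X q ≠ 0

variable (n) in
/-- The space `Λ²(T_p M)` of bivectors at `p`. -/
abbrev Bivector (p : M) : Type _ := ⋀[ℝ]^2 (TangentSpace (𝓡 n) p)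

/-- The simple bivector `x ∧ y`. -/
def wedge {p : M} (x y : TangentSpace (𝓡 n) p) : Bivector n p :=
  exteriorPower.ιMulti ℝ 2 ![x, y]

/-- A bivector is simple if it equals `x ∧ y` for some tangent vectors `x`, `y`. -/
def IsSimpleBivector {p : M} (b : Bivector n p) : Prop :=
  ∃ x y : TangentSpace (𝓡 n) p, b = wedge x y

variable (n) in
/-- The basis vector `∂_i` of `T_p M` given by the preferred chart at `p`. In Mathlib the space
`T_p M` is the model space, a vector being given by its components in the preferred chart at `p`. -/
def tangentBasis (p : M) (i : Fin n) : TangentSpace (𝓡 n) p :=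
  (EuclideanSpace.single i 1 : EuclideanSpace ℝ (Fin n))

variable (n) in
/-- The coordinate covector `dx^i` at `p`. -/
def tangentCoord (p : M) (i : Fin n) : Module.Dual ℝ (TangentSpace (𝓡 n) p) :=
  (EuclideanSpace.proj i : EuclideanSpace ℝ (Fin n) →L[ℝ] ℝ).toLinearMap

variable (n) in
/-- The component `b^{ij}` of a bivector `b = (1/2) ∑ b^{ij} ∂_i ∧ ∂_j`; for `b = x ∧ y` it is
`x^i y^j - x^j y^i`. -/
def bivectorCoord (p : M) (i j : Fin n) : Module.Dual ℝ (Bivector n p) :=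
  exteriorPower.pairingDual ℝ (TangentSpace (𝓡 n) p) 2
    (exteriorPower.ιMulti ℝ 2 ![tangentCoord n p i, tangentCoord n p j])

/-- The components at `p` of the `(0,4)` Weyl tensor of `g`. -/
def weylAt (g : SmoothMetric n M) (p : M) (i j k l : Fin n) : ℝ :=
  weyl (metricInChart g p) i j k l (extChartAt (𝓡 n) p p)

/-- The inverse matrix `g^{ij}` at `p`. -/
def inverseMetricAt (g : SmoothMetric n M) (p : M) : Matrix (Fin n) (Fin n) ℝ :=
  (metricInChart g p (extChartAt (𝓡 n) p p))⁻¹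

/-- The Weyl tensor as an endomorphism of `Λ²(T_p M)`. It is the operator with
`⟨W (x ∧ y), z ∧ t⟩ = W(x, y, z, t)` for the inner product
`⟨x ∧ y, z ∧ t⟩ = g(x, z) g(y, t) - g(x, t) g(y, z)`; in components,
`W (∂_i ∧ ∂_j) = (1/2) ∑ W_{ijab} g^{ak} g^{bl} ∂_k ∧ ∂_l`. -/
def weylOperator (g : SmoothMetric n M) (p : M) : Module.End ℝ (Bivector n p) :=
  ∑ i, ∑ j, ∑ k, ∑ l,
    ((1 / 4) * ∑ a, ∑ b,
      weylAt g p i j a b * inverseMetricAt g p a k * inverseMetricAt g p b l) •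
      (bivectorCoord n p i j).smulRight (wedge (tangentBasis n p k) (tangentBasis n p l))

/-- The set `v ∧ v^⊥ = {v ∧ w | g(v, w) = 0}` of bivectors at `p`. -/
def flag (g : SmoothMetric n M) (p : M) (v : TangentSpace (𝓡 n) p) : Set (Bivector n p) :=
  {b | ∃ w : TangentSpace (𝓡 n) p, g.inner p v w = 0 ∧ b = wedge v w}

end Global

end ConformalWeyl

end

/-! Let `X` be parallel for a metric g₀ of the class. Commuting second derivatives of `X` shows that
the curvature of g₀ annihilates `X` (`sum_riemann_mul_eq_zero`), so Ric kills `X` as well and S(X,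
·) = -σ g₀(X, ·) with σ = s / (2(n-1)(n-2)). Inserting `X` into W = R - S ∧ g₀ (Kulkarni-Nomizu)
removes R and leaves (`sum_weyl_mul`, `IsCurvatureNull.weylOperator_wedge`) W(X ∧ w) = X ∧ Φw, where
Φ is the g₀-self-adjoint endomorphism of the form σ g₀ - S (`weylEndomorphism`). Since ΦX = 2σX, Φ
preserves X^⊥, hence W preserves X ∧ X^⊥. As X ∧ · is injective on X^⊥, an eigenbasis of Φ
restricted to X^⊥ yields n - 1 independent simple eigenvectors of W
(`IsCurvatureNull.exists_eigenvectors`).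

Passing to e^{2f}g₀ changes R into e^{2f}(R - T ∧ g₀) (`riemann_conformal`). The Schouten tensor
absorbs T, so the (0,4) Weyl tensor is multiplied by e^{2f} (`weylOf_conformal`) and its operator by
e^{-2f} (`weylOperator_conformal`). Orthogonality is conformally invariant, so the same vector and
the same bivectors serve the whole class.

Finally, |X|² is locally constant, so `X` vanishes nowhere and v = X(p) is admissible at every p
(`IsParallel.ne_zero`). -/

noncomputable section

namespace ConformalWeyl

/-! ### Metrics and vector fields in chart coordinates -/

section Charts

open Bundle

variable {n : ℕ} {M : Type*} [TopologicalSpace M] [ChartedSpace (EuclideanSpace ℝ (Fin n)) M]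

lemma isOpen_target (p : M) : IsOpen (extChartAt (𝓡 n) p).target :=
  isOpen_extChartAt_target p

lemma mfderiv_symm_eq_sum (p : M) (y u : EuclideanSpace ℝ (Fin n)) :
    mfderiv 𝓘(ℝ, EuclideanSpace ℝ (Fin n)) (𝓡 n) (extChartAt (𝓡 n) p).symm y u
      = ∑ k, u k • coordField p k y := by
  set L : EuclideanSpace ℝ (Fin n) →L[ℝ] EuclideanSpace ℝ (Fin n) :=
    mfderiv 𝓘(ℝ, EuclideanSpace ℝ (Fin n)) (𝓡 n) (extChartAt (𝓡 n) p).symm y with hL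
  change L u = ∑ k, u k • L (EuclideanSpace.single k 1)
  have hu : u = ∑ k, u k • (EuclideanSpace.single k 1 : EuclideanSpace ℝ (Fin n)) := by
    ext j
    simp [Finset.sum_apply, Pi.single_apply]
  conv_lhs => rw [hu]
  simp [map_sum]

variable [IsManifold (𝓡 n) ∞ M]

lemma contMDiffOn_symm (p : M) :
    ContMDiffOn 𝓘(ℝ, EuclideanSpace ℝ (Fin n)) (𝓡 n) ∞ (extChartAt (𝓡 n) p).symm
      (extChartAt (𝓡 n) p).target :=
  contMDiffOn_extChartAt_symm p

lemma isManifold_one : IsManifold (𝓡 n) 1 M := IsManifold.of_le (n := ∞) (by simp)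

lemma isInvertible_mfderiv_symm (p : M) {y : EuclideanSpace ℝ (Fin n)}
    (hy : y ∈ (extChartAt (𝓡 n) p).target) :
    (mfderiv 𝓘(ℝ, EuclideanSpace ℝ (Fin n)) (𝓡 n) (extChartAt (𝓡 n) p).symm y).IsInvertible := by
  have : IsManifold (𝓡 n) 1 M := isManifold_one
  have h := isInvertible_mfderivWithin_extChartAt_symm (I := 𝓡 n) hy
  have hr : Set.range (𝓡 n) = Set.univ := by simp
  rwa [hr, mfderivWithin_univ] at h

lemma mfderiv_symm_mfderiv (p : M) {y : EuclideanSpace ℝ (Fin n)}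
    (hy : y ∈ (extChartAt (𝓡 n) p).target)
    (v : TangentSpace (𝓡 n) ((extChartAt (𝓡 n) p).symm y)) :
    mfderiv 𝓘(ℝ, EuclideanSpace ℝ (Fin n)) (𝓡 n) (extChartAt (𝓡 n) p).symm y
      (mfderiv (𝓡 n) 𝓘(ℝ, EuclideanSpace ℝ (Fin n)) (extChartAt (𝓡 n) p)
        ((extChartAt (𝓡 n) p).symm y) v) = v := by
  have : IsManifold (𝓡 n) 1 M := isManifold_one
  have h := mfderivWithin_extChartAt_symm_comp_mfderiv_extChartAt (I := 𝓡 n) hy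
  have hr : Set.range (𝓡 n) = Set.univ := by simp
  rw [hr, mfderivWithin_univ] at h
  exact congrArg (fun L => L v) h

lemma mfderiv_symm_self (p : M) :
    mfderiv 𝓘(ℝ, EuclideanSpace ℝ (Fin n)) (𝓡 n) (extChartAt (𝓡 n) p).symm
      (extChartAt (𝓡 n) p p) = ContinuousLinearMap.id ℝ (EuclideanSpace ℝ (Fin n)) := by
  have : IsManifold (𝓡 n) 1 M := isManifold_one
  have h := mfderivWithin_range_extChartAt_symm (I := 𝓡 n) (x := p)
  have hr : Set.range (𝓡 n) = Set.univ := by simp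
  rwa [hr, mfderivWithin_univ] at h

/-- The quadratic form of the metric in terms of components. -/
lemma inner_mfderiv_symm (g : SmoothMetric n M) (p : M) (y u w : EuclideanSpace ℝ (Fin n)) :
    g.inner ((extChartAt (𝓡 n) p).symm y)
      (mfderiv 𝓘(ℝ, EuclideanSpace ℝ (Fin n)) (𝓡 n) (extChartAt (𝓡 n) p).symm y u)
      (mfderiv 𝓘(ℝ, EuclideanSpace ℝ (Fin n)) (𝓡 n) (extChartAt (𝓡 n) p).symm y w)
      = ∑ i, ∑ j, metricInChart g p y i j * u i * w j := by
  rw [mfderiv_symm_eq_sum, mfderiv_symm_eq_sum]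
  simp only [map_sum, map_smul, sum_apply, smul_apply,
    smul_eq_mul, metricInChart, Matrix.of_apply]
  simp only [Finset.mul_sum]
  rw [Finset.sum_comm]
  refine Finset.sum_congr rfl fun i _ => Finset.sum_congr rfl fun j _ => ?_
  ring

lemma inner_eq_sum (g : SmoothMetric n M) (p : M) (v w : EuclideanSpace ℝ (Fin n)) :
    g.inner p v w = ∑ i, ∑ j, metricInChart g p (extChartAt (𝓡 n) p p) i j * v i * w j := by
  rw [← inner_mfderiv_symm, mfderiv_symm_self]
  -- The base point on the left is only propositionally equal to p. Generalizing it to q allows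
  -- substitution despite the dependent tangent space.
  have aux : ∀ q, q = p → g.inner p v w = g.inner q v w := by
    rintro q rfl; rfl
  exact aux _ (extChartAt_to_inv (I := 𝓡 n) p)

lemma inner_field_eq_sum (g : SmoothMetric n M) (X : ∀ q : M, TangentSpace (𝓡 n) q) (p : M)
    {y : EuclideanSpace ℝ (Fin n)} (hy : y ∈ (extChartAt (𝓡 n) p).target) :
    g.inner ((extChartAt (𝓡 n) p).symm y) (X ((extChartAt (𝓡 n) p).symm y))
        (X ((extChartAt (𝓡 n) p).symm y))
      = ∑ i, ∑ j, metricInChart g p y i j * fieldInChart X p i y * fieldInChart X p j y := by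
  have h := inner_mfderiv_symm g p y
    (mfderiv (𝓡 n) 𝓘(ℝ, EuclideanSpace ℝ (Fin n)) (extChartAt (𝓡 n) p)
        ((extChartAt (𝓡 n) p).symm y) (X ((extChartAt (𝓡 n) p).symm y)))
    (mfderiv (𝓡 n) 𝓘(ℝ, EuclideanSpace ℝ (Fin n)) (extChartAt (𝓡 n) p)
        ((extChartAt (𝓡 n) p).symm y) (X ((extChartAt (𝓡 n) p).symm y)))
  rw [mfderiv_symm_mfderiv p hy] at h
  exact h

lemma fieldInChart_self (X : ∀ q : M, TangentSpace (𝓡 n) q) (p : M) (k : Fin n) :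
    fieldInChart X p k (extChartAt (𝓡 n) p p) = tangentCoord n p k (X p) := by
  have : IsManifold (𝓡 n) 1 M := isManifold_one
  have aux : ∀ q, q = p → (EuclideanSpace.proj k : EuclideanSpace ℝ (Fin n) →L[ℝ] ℝ)
    (mfderiv (𝓡 n) 𝓘(ℝ, EuclideanSpace ℝ (Fin n)) (extChartAt (𝓡 n) p) q (X q))
      = tangentCoord n p k (X p) := by
    rintro q rfl
    rw [mfderiv_extChartAt_self]
    rfl
  exact aux _ (extChartAt_to_inv (I := 𝓡 n) p)

lemma metricInChart_symm (g : SmoothMetric n M) (p : M) (y : EuclideanSpace ℝ (Fin n))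
    (i j : Fin n) : metricInChart g p y i j = metricInChart g p y j i :=
  g.symm _ _ _

/-- A kernel vector of the matrix would give a tangent vector of length zero. It is non-zero because
the inverse chart has injective derivative, which contradicts positivity. -/
lemma isUnit_det_metricInChart (g : SmoothMetric n M) (p : M) {y : EuclideanSpace ℝ (Fin n)}
    (hy : y ∈ (extChartAt (𝓡 n) p).target) : IsUnit (metricInChart g p y).det := by
  rw [isUnit_iff_ne_zero]
  intro h0
  obtain ⟨c, hc, hGc⟩ := Matrix.exists_mulVec_eq_zero_iff.mpr h0
  have hinj := (isInvertible_mfderiv_symm p hy).injective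
  have hne : mfderiv 𝓘(ℝ, EuclideanSpace ℝ (Fin n)) (𝓡 n) (extChartAt (𝓡 n) p).symm y
      (WithLp.toLp 2 c : EuclideanSpace ℝ (Fin n)) ≠ 0 := by
    intro h
    apply hc
    have := hinj (h.trans (map_zero _).symm)
    exact congrArg WithLp.ofLp this
  have hpos := g.pos _ _ hne
  rw [inner_mfderiv_symm] at hpos
  refine hpos.ne' ?_
  refine Finset.sum_eq_zero fun i _ => ?_
  have hi := congrFun hGc i
  simp only [Matrix.mulVec, dotProduct, Pi.zero_apply] at hi
  calc _ = c i * ∑ j, metricInChart g p y i j * c j := by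
        rw [Finset.mul_sum]; exact Finset.sum_congr rfl fun j _ => by ring
    _ = 0 := by rw [hi, mul_zero]

lemma contMDiffOn_coordField (p : M) (i : Fin n) :
    ContMDiffOn 𝓘(ℝ, EuclideanSpace ℝ (Fin n)) (𝓡 n).tangent ∞
      (fun y => (⟨(extChartAt (𝓡 n) p).symm y, coordField p i y⟩ : TangentBundle (𝓡 n) M))
      (extChartAt (𝓡 n) p).target := by
  have : IsManifold (𝓡 n) 1 M := isManifold_one
  have h1 := (contMDiffOn_symm p).contMDiffOn_tangentMapWithin (m := ∞) le_rfl
    (isOpen_target (n := n) p).uniqueMDiffOn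
  have h2 : ContMDiffOn 𝓘(ℝ, EuclideanSpace ℝ (Fin n)) 𝓘(ℝ, EuclideanSpace ℝ (Fin n)).tangent ∞
      (fun y => (⟨y, EuclideanSpace.single i 1⟩ :
        TangentBundle 𝓘(ℝ, EuclideanSpace ℝ (Fin n)) (EuclideanSpace ℝ (Fin n))))
      (extChartAt (𝓡 n) p).target :=
    contMDiffOn_vectorSpace_iff_contDiffOn.mpr contDiffOn_const
  refine (h1.comp h2 (fun y hy => hy)).congr fun y hy => ?_
  simp only [Function.comp, tangentMapWithin, coordField]
  rw [mfderivWithin_of_isOpen (isOpen_target p) hy]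

lemma contDiffOn_metricInChart (g : SmoothMetric n M) (p : M) (i j : Fin n) :
    ContDiffOn ℝ ∞ (fun y => metricInChart g p y i j) (extChartAt (𝓡 n) p).target := by
  rw [← contMDiffOn_iff_contDiffOn]
  intro y hy
  have hi := contMDiffOn_coordField p i y hy
  have hj := contMDiffOn_coordField p j y hy
  have : ContMDiffWithinAt 𝓘(ℝ, EuclideanSpace ℝ (Fin n)) ((𝓡 n).prod 𝓘(ℝ)) ∞
      (fun y ↦ TotalSpace.mk' ℝ (E := Bundle.Trivial M ℝ) ((extChartAt (𝓡 n) p).symm y)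
        (metricInChart g p y i j)) (extChartAt (𝓡 n) p).target y := by
    apply ContMDiffWithinAt.clm_bundle_apply₂ (F₁ := EuclideanSpace ℝ (Fin n))
      (F₂ := EuclideanSpace ℝ (Fin n))
    · exact ContMDiffAt.comp_contMDiffWithinAt y g.contMDiff.contMDiffAt (contMDiffOn_symm p y hy)
    · exact hi
    · exact hj
  simp only [contMDiffWithinAt_totalSpace] at this
  exact this.2

lemma contDiffOn_fieldInChart {X : ∀ q : M, TangentSpace (𝓡 n) q} (hX : IsSmoothVectorField X)
    (p : M) (k : Fin n) :
    ContDiffOn ℝ ∞ (fieldInChart X p k) (extChartAt (𝓡 n) p).target := by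
  have : IsManifold (𝓡 n) 1 M := isManifold_one
  have ho : IsOpen (chartAt (EuclideanSpace ℝ (Fin n)) p).source :=
    (chartAt (EuclideanSpace ℝ (Fin n)) p).open_source
  have hmaps : ∀ y ∈ (extChartAt (𝓡 n) p).target,
      (extChartAt (𝓡 n) p).symm y ∈ (chartAt (EuclideanSpace ℝ (Fin n)) p).source := by
    intro y hy
    rw [← extChartAt_source (𝓡 n)]
    exact (extChartAt (𝓡 n) p).map_target hy
  have h1 := (contMDiffOn_extChartAt (I := 𝓡 n) (n := ∞) (x := p)).contMDiffOn_tangentMapWithin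
    (m := ∞) le_rfl ho.uniqueMDiffOn
  have h2 := hX.comp_contMDiffOn (contMDiffOn_symm p)
  have h3 := (contMDiff_snd_tangentBundle_modelSpace (n := ∞) (EuclideanSpace ℝ (Fin n))
    𝓘(ℝ, EuclideanSpace ℝ (Fin n))).comp_contMDiffOn (h1.comp h2 hmaps)
  rw [contMDiffOn_iff_contDiffOn] at h3
  have h4 := ((EuclideanSpace.proj k : EuclideanSpace ℝ (Fin n) →L[ℝ] ℝ).contDiff (n := ∞)).comp_contDiffOn h3
  refine h4.congr fun y hy => ?_
  simp only [Function.comp, tangentMapWithin, fieldInChart]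
  rw [mfderivWithin_of_isOpen ho (hmaps y hy)]

end Charts

/-! ### Calculus of partial derivatives -/

section PartialDeriv

variable {n : ℕ} {U : Set (EuclideanSpace ℝ (Fin n))} {f f₁ f₂ : EuclideanSpace ℝ (Fin n) → ℝ}
  {y : EuclideanSpace ℝ (Fin n)}

lemma differentiableAt_of_contDiffOn (hU : IsOpen U) (hf : ContDiffOn ℝ ∞ f U) (hy : y ∈ U) :
    DifferentiableAt ℝ f y :=
  (hf.contDiffAt (hU.mem_nhds hy)).differentiableAt (by simp)

lemma contDiffOn_partialDeriv (hU : IsOpen U) (hf : ContDiffOn ℝ ∞ f U) (i : Fin n) :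
    ContDiffOn ℝ ∞ (partialDeriv i f) U :=
  (hf.fderiv_of_isOpen hU (m := ∞) le_rfl).clm_apply contDiffOn_const

lemma partialDeriv_comm (hU : IsOpen U) (hf : ContDiffOn ℝ ∞ f U) (hy : y ∈ U) (i j : Fin n) :
    partialDeriv i (partialDeriv j f) y = partialDeriv j (partialDeriv i f) y := by
  have hd : DifferentiableAt ℝ (fderiv ℝ f) y :=
    ((hf.fderiv_of_isOpen hU (m := ∞) le_rfl).contDiffAt (hU.mem_nhds hy)).differentiableAt
      (by simp)
  have key : ∀ u w : EuclideanSpace ℝ (Fin n),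
      fderiv ℝ (fun z => fderiv ℝ f z u) y w = fderiv ℝ (fderiv ℝ f) y w u := by
    intro u w
    rw [fderiv_clm_apply hd (differentiableAt_const u)]
    simp
  have hs : IsSymmSndFDerivAt ℝ f y :=
    (hf.contDiffAt (hU.mem_nhds hy)).isSymmSndFDerivAt
      (by simpa using ENat.LEInfty.out)
  change fderiv ℝ (fun z => fderiv ℝ f z _) y _ = fderiv ℝ (fun z => fderiv ℝ f z _) y _
  rw [key, key]
  exact hs _ _

lemma partialDeriv_congr (hU : IsOpen U) (h : ∀ z ∈ U, f₁ z = f₂ z) (hy : y ∈ U) (i : Fin n) :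
    partialDeriv i f₁ y = partialDeriv i f₂ y := by
  unfold partialDeriv
  rw [Filter.EventuallyEq.fderiv_eq (Filter.eventuallyEq_of_mem (hU.mem_nhds hy) h)]

lemma partialDeriv_const (i : Fin n) (c : ℝ) :
    partialDeriv i (fun _ => c) y = 0 := by
  simp [partialDeriv]

lemma partialDeriv_add (h₁ : DifferentiableAt ℝ f₁ y) (h₂ : DifferentiableAt ℝ f₂ y)
    (i : Fin n) : partialDeriv i (fun z => f₁ z + f₂ z) y
      = partialDeriv i f₁ y + partialDeriv i f₂ y := by
  unfold partialDeriv
  rw [fderiv_fun_add h₁ h₂]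
  rfl

lemma partialDeriv_sub (h₁ : DifferentiableAt ℝ f₁ y) (h₂ : DifferentiableAt ℝ f₂ y)
    (i : Fin n) : partialDeriv i (fun z => f₁ z - f₂ z) y
      = partialDeriv i f₁ y - partialDeriv i f₂ y := by
  unfold partialDeriv
  rw [fderiv_fun_sub h₁ h₂]
  rfl

lemma partialDeriv_mul (h₁ : DifferentiableAt ℝ f₁ y) (h₂ : DifferentiableAt ℝ f₂ y)
    (i : Fin n) : partialDeriv i (fun z => f₁ z * f₂ z) y
      = partialDeriv i f₁ y * f₂ y + f₁ y * partialDeriv i f₂ y := by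
  unfold partialDeriv
  rw [fderiv_fun_mul h₁ h₂]
  simp
  ring

lemma partialDeriv_const_mul (h : DifferentiableAt ℝ f y) (c : ℝ) (i : Fin n) :
    partialDeriv i (fun z => c * f z) y = c * partialDeriv i f y := by
  rw [partialDeriv_mul (differentiableAt_const c) h, partialDeriv_const]
  ring

lemma partialDeriv_neg (i : Fin n) :
    partialDeriv i (fun z => - f z) y = - partialDeriv i f y := by
  unfold partialDeriv
  rw [fderiv_fun_neg]
  rfl

lemma partialDeriv_sum {ι : Type*} {s : Finset ι} {F : ι → EuclideanSpace ℝ (Fin n) → ℝ}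
    (h : ∀ a ∈ s, DifferentiableAt ℝ (F a) y) (i : Fin n) :
    partialDeriv i (fun z => ∑ a ∈ s, F a z) y = ∑ a ∈ s, partialDeriv i (F a) y := by
  unfold partialDeriv
  rw [fderiv_fun_sum h]
  simp

lemma partialDeriv_exp_two_mul (h : DifferentiableAt ℝ f y) (i : Fin n) :
    partialDeriv i (fun z => Real.exp (2 * f z)) y
      = Real.exp (2 * f y) * (2 * partialDeriv i f y) := by
  unfold partialDeriv
  rw [fderiv_exp (h.const_mul 2), fderiv_const_mul h]
  simp

end PartialDeriv

/-! ### Levi-Civita connection and symmetries of the curvature -/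

section LeviCivita

variable {n : ℕ}

/-- `G` is the component matrix of a smooth pseudo-Riemannian metric on the open set `U`. -/
structure IsMetricOn (G : EuclideanSpace ℝ (Fin n) → Matrix (Fin n) (Fin n) ℝ)
    (U : Set (EuclideanSpace ℝ (Fin n))) : Prop where
  isOpen : IsOpen U
  contDiffOn : ∀ i j, ContDiffOn ℝ ∞ (fun y => G y i j) U
  symm : ∀ y ∈ U, ∀ i j, G y i j = G y j i
  isUnit_det : ∀ y ∈ U, IsUnit (G y).det

variable (G : EuclideanSpace ℝ (Fin n) → Matrix (Fin n) (Fin n) ℝ)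

/-- The Christoffel symbols of the first kind, `Γ_{k,ij} = ∑ g_{km} Γ^m_{ij}`. -/
def christoffelLower (k i j : Fin n) (y : EuclideanSpace ℝ (Fin n)) : ℝ :=
  (1 / 2) * (partialDeriv i (fun z => G z j k) y + partialDeriv j (fun z => G z i k) y
      - partialDeriv k (fun z => G z i j) y)

variable {G} {U : Set (EuclideanSpace ℝ (Fin n))} {y : EuclideanSpace ℝ (Fin n)}

lemma christoffel_eq (k i j : Fin n) (y : EuclideanSpace ℝ (Fin n)) :
    christoffel G k i j y = ∑ l, (G y)⁻¹ k l * christoffelLower G l i j y := by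
  unfold christoffel christoffelLower
  rw [Finset.mul_sum]
  exact Finset.sum_congr rfl fun l _ => by ring

lemma sum_mul_inv {A : Matrix (Fin n) (Fin n) ℝ} (hA : IsUnit A.det) (i k : Fin n) :
    ∑ j, A i j * A⁻¹ j k = if i = k then 1 else 0 := by
  have := congrFun (congrFun (Matrix.mul_nonsing_inv A hA) i) k
  rwa [Matrix.mul_apply, Matrix.one_apply] at this

lemma sum_inv_mul {A : Matrix (Fin n) (Fin n) ℝ} (hA : IsUnit A.det) (i k : Fin n) :
    ∑ j, A⁻¹ i j * A j k = if i = k then 1 else 0 := by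
  have := congrFun (congrFun (Matrix.nonsing_inv_mul A hA) i) k
  rwa [Matrix.mul_apply, Matrix.one_apply] at this

lemma sum_mul_sum_inv {A : Matrix (Fin n) (Fin n) ℝ} (hA : IsUnit A.det) (c : Fin n → ℝ)
    (k : Fin n) : ∑ m, A k m * ∑ a, A⁻¹ m a * c a = c k := by
  simp only [Finset.mul_sum]
  rw [Finset.sum_comm]
  simp only [← mul_assoc, ← Finset.sum_mul, sum_mul_inv hA]
  simp

lemma inv_symm {A : Matrix (Fin n) (Fin n) ℝ} (hA : ∀ i j, A i j = A j i) (i j : Fin n) :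
    A⁻¹ i j = A⁻¹ j i := by
  have h : A.transpose = A := by ext i j; exact hA j i
  have h2 := Matrix.transpose_nonsing_inv A
  rw [h] at h2
  exact (congrFun (congrFun h2 j) i)

lemma contDiffOn_det {A : EuclideanSpace ℝ (Fin n) → Matrix (Fin n) (Fin n) ℝ}
    (hA : ∀ i j, ContDiffOn ℝ ∞ (fun y => A y i j) U) : ContDiffOn ℝ ∞ (fun y => (A y).det) U := by
  simp only [Matrix.det_apply']
  refine ContDiffOn.sum fun σ _ => contDiffOn_const.mul ?_
  exact contDiffOn_prod fun i _ => hA _ _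

namespace IsMetricOn

lemma differentiableAt (hG : IsMetricOn G U) (hy : y ∈ U) (i j : Fin n) :
    DifferentiableAt ℝ (fun z => G z i j) y :=
  differentiableAt_of_contDiffOn hG.isOpen (hG.contDiffOn i j) hy

lemma contDiffOn_inv (hG : IsMetricOn G U) (i j : Fin n) :
    ContDiffOn ℝ ∞ (fun y => (G y)⁻¹ i j) U := by
  -- Cramer's rule: an entry of the inverse is the reciprocal of the determinant times the
  -- determinant of the matrix with one row replaced by a unit vector.
  simp only [Matrix.inv_def, Matrix.smul_apply, Matrix.adjugate_apply, smul_eq_mul,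
    Ring.inverse_eq_inv']
  refine ContDiffOn.mul ?_ ?_
  · exact (contDiffOn_det hG.contDiffOn).inv fun y hy => (hG.isUnit_det y hy).ne_zero
  · refine contDiffOn_det fun a b => ?_
    by_cases h : a = j
    · subst h; simpa using contDiffOn_const
    · simpa [Matrix.updateRow_ne h] using hG.contDiffOn a b

lemma contDiffOn_christoffelLower (hG : IsMetricOn G U) (k i j : Fin n) :
    ContDiffOn ℝ ∞ (christoffelLower G k i j) U :=
  contDiffOn_const.mul
    (((contDiffOn_partialDeriv hG.isOpen (hG.contDiffOn _ _) _).add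
      (contDiffOn_partialDeriv hG.isOpen (hG.contDiffOn _ _) _)).sub
      (contDiffOn_partialDeriv hG.isOpen (hG.contDiffOn _ _) _))

lemma contDiffOn_christoffel (hG : IsMetricOn G U) (k i j : Fin n) :
    ContDiffOn ℝ ∞ (christoffel G k i j) U := by
  have : christoffel G k i j = fun y => ∑ l, (G y)⁻¹ k l * christoffelLower G l i j y :=
    funext fun y => christoffel_eq k i j y
  rw [this]
  exact ContDiffOn.sum fun l _ => (hG.contDiffOn_inv k l).mul (hG.contDiffOn_christoffelLower l i j)

lemma sum_mul_christoffel (hG : IsMetricOn G U) (hy : y ∈ U) (k i j : Fin n) :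
    ∑ m, G y k m * christoffel G m i j y = christoffelLower G k i j y := by
  simp only [christoffel_eq]
  exact sum_mul_sum_inv (hG.isUnit_det y hy) (fun l => christoffelLower G l i j y) k

lemma partialDeriv_symm (hG : IsMetricOn G U) (hy : y ∈ U) (k i j : Fin n) :
    partialDeriv k (fun z => G z i j) y = partialDeriv k (fun z => G z j i) y :=
  partialDeriv_congr hG.isOpen (fun z hz => hG.symm z hz i j) hy k

lemma christoffelLower_comm (hG : IsMetricOn G U) (hy : y ∈ U) (k i j : Fin n) :
    christoffelLower G k i j y = christoffelLower G k j i y := by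
  unfold christoffelLower
  rw [hG.partialDeriv_symm hy k i j]
  ring

lemma christoffel_comm (hG : IsMetricOn G U) (hy : y ∈ U) (k i j : Fin n) :
    christoffel G k i j y = christoffel G k j i y := by
  simp only [christoffel_eq]
  exact Finset.sum_congr rfl fun l _ => by rw [hG.christoffelLower_comm hy]

/-- Metric compatibility of the Levi-Civita connection. -/
lemma partialDeriv_metric (hG : IsMetricOn G U) (hy : y ∈ U) (i j k : Fin n) :
    partialDeriv i (fun z => G z j k) y
      = christoffelLower G k i j y + christoffelLower G j i k y := by
  unfold christoffelLower
  rw [hG.partialDeriv_symm hy i k j, hG.partialDeriv_symm hy j i k, hG.partialDeriv_symm hy k i j]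
  ring

/-- Differentiating the lowered identity for Γ, with metric compatibility for ∂g, avoids ever
differentiating the inverse metric. -/
lemma sum_mul_partialDeriv_christoffel (hG : IsMetricOn G U) (hy : y ∈ U) (i j k l : Fin n) :
    ∑ m, G y k m * partialDeriv i (christoffel G m j l) y
      = partialDeriv i (christoffelLower G k j l) y
        - ∑ m, (christoffelLower G m i k y + christoffelLower G k i m y)
          * christoffel G m j l y := by
  have hd : ∀ m, DifferentiableAt ℝ (christoffel G m j l) y := fun m =>
    differentiableAt_of_contDiffOn hG.isOpen (hG.contDiffOn_christoffel m j l) hy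
  have h := partialDeriv_congr hG.isOpen (fun z hz => hG.sum_mul_christoffel hz k j l) hy i
  rw [partialDeriv_sum fun m _ => (hG.differentiableAt hy k m).fun_mul (hd m)] at h
  rw [← h, ← Finset.sum_sub_distrib]
  refine Finset.sum_congr rfl fun m _ => ?_
  rw [partialDeriv_mul (hG.differentiableAt hy k m) (hd m), hG.partialDeriv_metric hy]
  ring

/-- Half of the quadratic terms produced by lowering cancel against those of `curvatureUp`. The form
that remains makes the pair symmetry visible. -/
lemma riemann_eq (hG : IsMetricOn G U) (hy : y ∈ U) (i j k l : Fin n) :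
    riemann G i j k l y = partialDeriv i (christoffelLower G k j l) y
      - partialDeriv j (christoffelLower G k i l) y
      - ∑ m, christoffelLower G m i k y * christoffel G m j l y
      + ∑ m, christoffelLower G m j k y * christoffel G m i l y := by
  have h₁ := hG.sum_mul_partialDeriv_christoffel hy i j k l
  have h₂ := hG.sum_mul_partialDeriv_christoffel hy j i k l
  have h₃ : ∀ i j, ∑ m, G y k m * ∑ s, christoffel G m i s y * christoffel G s j l y
      = ∑ s, christoffelLower G k i s y * christoffel G s j l y := by
    intro i j
    simp only [Finset.mul_sum]
    rw [Finset.sum_comm]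
    simp only [← mul_assoc, ← Finset.sum_mul, hG.sum_mul_christoffel hy]
  have h₄ := h₃ i j
  have h₅ := h₃ j i
  simp only [add_mul, Finset.sum_add_distrib] at h₁ h₂
  unfold riemann curvatureUp
  simp only [Finset.sum_sub_distrib, mul_add, mul_sub, Finset.sum_add_distrib]
  rw [h₁, h₂, h₄, h₅]
  ring

lemma sum_christoffelLower_mul_comm (hG : IsMetricOn G U) (hy : y ∈ U) (i j k l : Fin n) :
    ∑ m, christoffelLower G m i k y * christoffel G m j l y
      = ∑ m, christoffelLower G m j l y * christoffel G m i k y := by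
  simp only [← hG.sum_mul_christoffel hy, Finset.sum_mul]
  rw [Finset.sum_comm]
  refine Finset.sum_congr rfl fun a _ => Finset.sum_congr rfl fun b _ => ?_
  rw [hG.symm y hy a b]
  ring

lemma partialDeriv_christoffelLower (hG : IsMetricOn G U) (hy : y ∈ U) (i k j l : Fin n) :
    partialDeriv i (christoffelLower G k j l) y
      = (1 / 2) * (partialDeriv i (partialDeriv j (fun z => G z l k)) y
        + partialDeriv i (partialDeriv l (fun z => G z j k)) y
        - partialDeriv i (partialDeriv k (fun z => G z j l)) y) := by
  have hd : ∀ a b c, DifferentiableAt ℝ (partialDeriv a (fun z => G z b c)) y := fun a b c =>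
    differentiableAt_of_contDiffOn hG.isOpen
      (contDiffOn_partialDeriv hG.isOpen (hG.contDiffOn b c) a) hy
  unfold christoffelLower
  rw [partialDeriv_const_mul (((hd _ _ _).fun_add (hd _ _ _)).fun_sub (hd _ _ _)),
    partialDeriv_sub ((hd _ _ _).fun_add (hd _ _ _)) (hd _ _ _),
    partialDeriv_add (hd _ _ _) (hd _ _ _)]

/-- The second derivatives of g match by Schwarz and the symmetry of g; the quadratic terms match
because each is a g-product of two Christoffel vectors. This symmetry later moves a null vector from
the last slot of R to the first. -/
lemma riemann_pair_symm (hG : IsMetricOn G U) (hy : y ∈ U) (i j k l : Fin n) :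
    riemann G i j k l y = riemann G k l i j y := by
  have hc : ∀ a b c d, partialDeriv a (partialDeriv b (fun z => G z c d)) y
      = partialDeriv b (partialDeriv a (fun z => G z c d)) y := fun a b c d =>
    partialDeriv_comm hG.isOpen (hG.contDiffOn c d) hy a b
  have hs : ∀ a b c d, partialDeriv a (partialDeriv b (fun z => G z c d)) y
      = partialDeriv a (partialDeriv b (fun z => G z d c)) y := fun a b c d =>
    partialDeriv_congr hG.isOpen (fun z hz => hG.partialDeriv_symm hz b c d) hy a
  rw [hG.riemann_eq hy, hG.riemann_eq hy]
  simp only [hG.partialDeriv_christoffelLower hy]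
  rw [hG.sum_christoffelLower_mul_comm hy j i k l]
  have e₁ : ∑ m, christoffelLower G m k i y * christoffel G m l j y
      = ∑ m, christoffelLower G m i k y * christoffel G m j l y :=
    Finset.sum_congr rfl fun m _ => by
      rw [hG.christoffelLower_comm hy m k i, hG.christoffel_comm hy m l j]
  have e₂ : ∑ m, christoffelLower G m l i y * christoffel G m k j y
      = ∑ m, christoffelLower G m i l y * christoffel G m j k y :=
    Finset.sum_congr rfl fun m _ => by
      rw [hG.christoffelLower_comm hy m l i, hG.christoffel_comm hy m k j]
  rw [e₁, e₂]
  linear_combination (1 / 2) * (hc i j l k) + (1 / 2) * hc i l j k - (1 / 2) * hc i k j l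
    - (1 / 2) * hc j l i k + (1 / 2) * hc j k i l + (1 / 2) * hs l i j k - (1 / 2) * hs k i j l
    - (1 / 2) * hs l j i k + (1 / 2) * hs k j i l - (1 / 2) * hc k l j i

lemma riemann_swap (i j k l : Fin n) (y : EuclideanSpace ℝ (Fin n)) :
    riemann G j i k l y = - riemann G i j k l y := by
  unfold riemann
  rw [← Finset.sum_neg_distrib]
  refine Finset.sum_congr rfl fun m _ => ?_
  unfold curvatureUp
  simp only [Finset.sum_sub_distrib]
  ring

lemma ricci_symm (hG : IsMetricOn G U) (hy : y ∈ U) (i k : Fin n) :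
    ricci G i k y = ricci G k i y := by
  unfold ricci
  rw [Finset.sum_comm]
  refine Finset.sum_congr rfl fun a _ => Finset.sum_congr rfl fun b _ => ?_
  rw [hG.riemann_pair_symm hy, inv_symm (hG.symm y hy)]

lemma schouten_symm (hG : IsMetricOn G U) (hy : y ∈ U) (i k : Fin n) :
    schouten G i k y = schouten G k i y := by
  unfold schouten
  rw [hG.ricci_symm hy, hG.symm y hy]

end IsMetricOn

end LeviCivita

/-! ### Parallel fields in coordinates -/

section ParallelFields

variable {n : ℕ} {G : EuclideanSpace ℝ (Fin n) → Matrix (Fin n) (Fin n) ℝ}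
  {U : Set (EuclideanSpace ℝ (Fin n))} {y : EuclideanSpace ℝ (Fin n)}
  {X : Fin n → EuclideanSpace ℝ (Fin n) → ℝ}

namespace IsMetricOn

/-- The curvature annihilates a parallel field. -/
lemma sum_curvatureUp_mul_eq_zero (hG : IsMetricOn G U) (hX : ∀ k, ContDiffOn ℝ ∞ (X k) U)
    (hpar : ∀ z ∈ U, ∀ i k, partialDeriv i (X k) z + ∑ j, christoffel G k i j z * X j z = 0)
    (hy : y ∈ U) (m i j : Fin n) : ∑ l, curvatureUp G m i j l y * X l y = 0 := by
  have hd : ∀ k i j, DifferentiableAt ℝ (christoffel G k i j) y := fun k i j =>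
    differentiableAt_of_contDiffOn hG.isOpen (hG.contDiffOn_christoffel k i j) hy
  have hdX : ∀ k, DifferentiableAt ℝ (X k) y := fun k =>
    differentiableAt_of_contDiffOn hG.isOpen (hX k) hy
  have hsnd : ∀ i j, partialDeriv i (partialDeriv j (X m)) y
      = - (∑ l, partialDeriv i (christoffel G m j l) y * X l y)
        + ∑ l, (∑ s, christoffel G m j s y * christoffel G s i l y) * X l y := by
    intro i j
    rw [partialDeriv_congr hG.isOpen (fun z hz => eq_neg_of_add_eq_zero_left (hpar z hz j m)) hy i,
      partialDeriv_neg, partialDeriv_sum fun l _ => (hd m j l).fun_mul (hdX l)]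
    have h1 : ∀ l, partialDeriv i (fun z => christoffel G m j l z * X l z) y
        = partialDeriv i (christoffel G m j l) y * X l y
          - christoffel G m j l y * ∑ s, christoffel G l i s y * X s y := by
      intro l
      rw [partialDeriv_mul (hd m j l) (hdX l), eq_neg_of_add_eq_zero_left (hpar y hy i l)]
      ring
    simp only [h1, Finset.sum_sub_distrib, Finset.mul_sum, Finset.sum_mul]
    rw [Finset.sum_comm (f := fun x s => christoffel G m j x y * (christoffel G x i s y * X s y))]
    simp only [mul_assoc]
    ring
  -- Equality of mixed partials is the integrability condition of ∂X = -ΓX; the difference of the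
  -- two expansions is exactly the curvature applied to X.
  have hcomm := partialDeriv_comm hG.isOpen (hX m) hy i j
  rw [hsnd, hsnd] at hcomm
  unfold curvatureUp
  simp only [Finset.sum_sub_distrib, add_mul, sub_mul, Finset.sum_add_distrib]
  linarith

lemma sum_riemann_mul_eq_zero (hG : IsMetricOn G U) (hX : ∀ k, ContDiffOn ℝ ∞ (X k) U)
    (hpar : ∀ z ∈ U, ∀ i k, partialDeriv i (X k) z + ∑ j, christoffel G k i j z * X j z = 0)
    (hy : y ∈ U) (i j k : Fin n) : ∑ l, riemann G i j k l y * X l y = 0 := by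
  unfold riemann
  simp only [Finset.sum_mul]
  rw [Finset.sum_comm]
  simp only [mul_assoc, ← Finset.mul_sum, hG.sum_curvatureUp_mul_eq_zero hX hpar hy]
  simp

/-- The squared length of a parallel field has zero derivative. -/
lemma partialDeriv_sq_norm_eq_zero (hG : IsMetricOn G U) (hX : ∀ k, ContDiffOn ℝ ∞ (X k) U)
    (hpar : ∀ z ∈ U, ∀ i k, partialDeriv i (X k) z + ∑ j, christoffel G k i j z * X j z = 0)
    (hy : y ∈ U) (k : Fin n) :
    partialDeriv k (fun z => ∑ i, ∑ j, G z i j * X i z * X j z) y = 0 := by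
  have hdX : ∀ k, DifferentiableAt ℝ (X k) y := fun k =>
    differentiableAt_of_contDiffOn hG.isOpen (hX k) hy
  have hterm : ∀ i j, DifferentiableAt ℝ (fun z => G z i j * X i z * X j z) y := fun i j =>
    ((hG.differentiableAt hy i j).fun_mul (hdX i)).fun_mul (hdX j)
  -- The parallel equation with its free index lowered. It cancels the Christoffel symbols that
  -- metric compatibility produces from ∂g.
  have hlow : ∀ i, ∑ j, G y i j * partialDeriv k (X j) y
      = - ∑ s, christoffelLower G i k s y * X s y := by
    intro i
    simp only [fun j => eq_neg_of_add_eq_zero_left (hpar y hy k j), mul_neg,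
      Finset.sum_neg_distrib, Finset.mul_sum]
    rw [Finset.sum_comm]
    simp only [← mul_assoc, ← Finset.sum_mul, hG.sum_mul_christoffel hy]
  rw [partialDeriv_sum fun i _ => DifferentiableAt.fun_sum fun j _ => hterm i j]
  have h1 : ∀ i, partialDeriv k (fun z => ∑ j, G z i j * X i z * X j z) y
      = ∑ j, (christoffelLower G j k i y * X i y * X j y
        + christoffelLower G i k j y * X i y * X j y
        + G y j i * partialDeriv k (X i) y * X j y + G y i j * partialDeriv k (X j) y * X i y) := by
    intro i
    rw [partialDeriv_sum fun j _ => hterm i j]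
    refine Finset.sum_congr rfl fun j _ => ?_
    rw [partialDeriv_mul ((hG.differentiableAt hy i j).fun_mul (hdX i)) (hdX j),
      partialDeriv_mul (hG.differentiableAt hy i j) (hdX i), hG.partialDeriv_metric hy,
      hG.symm y hy j i]
    ring
  simp only [h1, Finset.sum_add_distrib]
  rw [Finset.sum_comm (f := fun i j => christoffelLower G j k i y * X i y * X j y),
    Finset.sum_comm (f := fun i j => G y j i * partialDeriv k (X i) y * X j y)]
  have h2 : ∑ i, ∑ j, G y i j * partialDeriv k (X j) y * X i y
      = - ∑ i, ∑ j, christoffelLower G i k j y * X j y * X i y := by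
    simp only [← Finset.sum_mul, hlow, neg_mul, Finset.sum_neg_distrib]
  have h3 : ∑ i, ∑ j, christoffelLower G i k j y * X i y * X j y
      = ∑ i, ∑ j, christoffelLower G i k j y * X j y * X i y :=
    Finset.sum_congr rfl fun i _ => Finset.sum_congr rfl fun j _ => by ring
  rw [h2, h3]
  ring

end IsMetricOn

end ParallelFields

/-! ### Curvature under a conformal change of metric -/

section ConformalChange

variable {n : ℕ}

variable (G : EuclideanSpace ℝ (Fin n) → Matrix (Fin n) (Fin n) ℝ)
  (f : EuclideanSpace ℝ (Fin n) → ℝ)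

/-- The components of the gradient of `f`. -/
def gradient (m : Fin n) (y : EuclideanSpace ℝ (Fin n)) : ℝ :=
  ∑ a, (G y)⁻¹ m a * partialDeriv a f y

/-- The squared length of the gradient of `f`. -/
def gradientSq (y : EuclideanSpace ℝ (Fin n)) : ℝ :=
  ∑ s, partialDeriv s f y * gradient G f s y

/-- The components of the Hessian of `f`. -/
def hessian (i j : Fin n) (y : EuclideanSpace ℝ (Fin n)) : ℝ :=
  partialDeriv i (partialDeriv j f) y - ∑ s, partialDeriv s f y * christoffel G s i j y

/-- The tensor `∇²f - df ⊗ df + |df|² g / 2` by which the Schouten tensor changes under the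
conformal change of metric with factor `e^{2f}`. -/
def schoutenChange (i j : Fin n) (y : EuclideanSpace ℝ (Fin n)) : ℝ :=
  hessian G f i j y - partialDeriv i f y * partialDeriv j f y
    + (1 / 2) * gradientSq G f y * G y i j

variable {G f} {G' : EuclideanSpace ℝ (Fin n) → Matrix (Fin n) (Fin n) ℝ}
  {U : Set (EuclideanSpace ℝ (Fin n))} {y : EuclideanSpace ℝ (Fin n)}

lemma inv_smul_of_isUnit_det {A : Matrix (Fin n) (Fin n) ℝ} {c : ℝ} (hc : c ≠ 0) (hA : IsUnit A.det) :
    (c • A)⁻¹ = c⁻¹ • A⁻¹ := by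
  apply Matrix.inv_eq_right_inv
  rw [Matrix.smul_mul, Matrix.mul_smul, smul_smul, mul_inv_cancel₀ hc, one_smul,
    Matrix.mul_nonsing_inv A hA]

namespace IsMetricOn

lemma sum_mul_gradient (hG : IsMetricOn G U) (hy : y ∈ U) (k : Fin n) :
    ∑ m, G y k m * gradient G f m y = partialDeriv k f y :=
  sum_mul_sum_inv (hG.isUnit_det y hy) (fun a => partialDeriv a f y) k

lemma contDiffOn_gradient (hG : IsMetricOn G U) (hf : ContDiffOn ℝ ∞ f U) (m : Fin n) :
    ContDiffOn ℝ ∞ (gradient G f m) U :=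
  ContDiffOn.sum fun a _ =>
    (hG.contDiffOn_inv m a).mul (contDiffOn_partialDeriv hG.isOpen hf a)

lemma sum_christoffelLower_mul_gradient (hG : IsMetricOn G U) (hy : y ∈ U) (i k : Fin n) :
    ∑ m, christoffelLower G m i k y * gradient G f m y
      = ∑ s, partialDeriv s f y * christoffel G s i k y := by
  simp only [← hG.sum_mul_christoffel hy, ← hG.sum_mul_gradient (f := f) hy, Finset.sum_mul]
  rw [Finset.sum_comm]
  refine Finset.sum_congr rfl fun a _ => Finset.sum_congr rfl fun b _ => ?_
  rw [hG.symm y hy a b]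
  ring

/-- Lowering the index of the covariant derivative of the gradient gives the Hessian. -/
lemma sum_mul_nabla_gradient (hG : IsMetricOn G U) (hf : ContDiffOn ℝ ∞ f U) (hy : y ∈ U)
    (i k : Fin n) :
    ∑ m, G y k m * (partialDeriv i (gradient G f m) y
      + ∑ s, christoffel G m i s y * gradient G f s y) = hessian G f i k y := by
  have hd : ∀ m, DifferentiableAt ℝ (gradient G f m) y := fun m =>
    differentiableAt_of_contDiffOn hG.isOpen (hG.contDiffOn_gradient hf m) hy
  have h := partialDeriv_congr hG.isOpen
    (fun z hz => hG.sum_mul_gradient (f := f) hz k) hy i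
  rw [partialDeriv_sum fun m _ => (hG.differentiableAt hy k m).fun_mul (hd m)] at h
  simp only [fun m => partialDeriv_mul (i := i) (hG.differentiableAt hy k m) (hd m),
    hG.partialDeriv_metric hy, add_mul, Finset.sum_add_distrib,
    hG.sum_christoffelLower_mul_gradient hy] at h
  have h2 : ∑ m, G y k m * ∑ s, christoffel G m i s y * gradient G f s y
      = ∑ s, christoffelLower G k i s y * gradient G f s y := by
    simp only [Finset.mul_sum]
    rw [Finset.sum_comm]
    simp only [← mul_assoc, ← Finset.sum_mul, hG.sum_mul_christoffel hy]
  simp only [mul_add, Finset.sum_add_distrib]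
  rw [h2]
  unfold hessian
  linear_combination h

/-- Each derivative of e^{2f}g contributes an extra 2 df ⊗ g. The exponential factor disappears when
the index is raised with the inverse metric. -/
lemma christoffel_conformal (hG : IsMetricOn G U) (hf : ContDiffOn ℝ ∞ f U)
    (hG' : ∀ z ∈ U, G' z = Real.exp (2 * f z) • G z) (hy : y ∈ U) (k i j : Fin n) :
    christoffel G' k i j y = christoffel G k i j y + (if k = i then 1 else 0) * partialDeriv j f y
      + (if k = j then 1 else 0) * partialDeriv i f y - G y i j * gradient G f k y := by
  have hdf : DifferentiableAt ℝ f y := differentiableAt_of_contDiffOn hG.isOpen hf hy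
  have hexp : DifferentiableAt ℝ (fun z => Real.exp (2 * f z)) y := (hdf.const_mul 2).exp
  have hpd : ∀ a b c, partialDeriv a (fun z => G' z b c) y
      = Real.exp (2 * f y) * (2 * partialDeriv a f y * G y b c
        + partialDeriv a (fun z => G z b c) y) := by
    intro a b c
    rw [partialDeriv_congr hG.isOpen
      (fun z hz => congrFun (congrFun (hG' z hz) b) c) hy a]
    simp only [Matrix.smul_apply, smul_eq_mul]
    rw [partialDeriv_mul hexp (hG.differentiableAt hy b c), partialDeriv_exp_two_mul hdf]
    ring
  have hlow : ∀ l, christoffelLower G' l i j y = Real.exp (2 * f y) *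
      (christoffelLower G l i j y + partialDeriv i f y * G y j l + partialDeriv j f y * G y i l
        - partialDeriv l f y * G y i j) := by
    intro l
    unfold christoffelLower
    rw [hpd, hpd, hpd]
    ring
  have hne : Real.exp (2 * f y) ≠ 0 := (Real.exp_pos _).ne'
  have hterm : ∀ l, (Real.exp (2 * f y))⁻¹ * (G y)⁻¹ k l * (Real.exp (2 * f y) *
      (christoffelLower G l i j y + partialDeriv i f y * G y j l + partialDeriv j f y * G y i l
        - partialDeriv l f y * G y i j))
      = (G y)⁻¹ k l * christoffelLower G l i j y + (G y)⁻¹ k l * G y l j * partialDeriv i f y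
        + (G y)⁻¹ k l * G y l i * partialDeriv j f y
        - G y i j * ((G y)⁻¹ k l * partialDeriv l f y) := by
    intro l
    rw [hG.symm y hy l j, hG.symm y hy l i]
    field_simp
  rw [christoffel_eq, christoffel_eq, hG' y hy, inv_smul_of_isUnit_det hne (hG.isUnit_det y hy)]
  simp only [Matrix.smul_apply, smul_eq_mul, hlow, hterm, Finset.sum_add_distrib,
    Finset.sum_sub_distrib, ← Finset.sum_mul, sum_inv_mul (hG.isUnit_det y hy), ← Finset.mul_sum]
  unfold gradient
  ring

lemma partialDeriv_christoffel_conformal (hG : IsMetricOn G U) (hf : ContDiffOn ℝ ∞ f U)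
    (hG' : ∀ z ∈ U, G' z = Real.exp (2 * f z) • G z) (hy : y ∈ U) (m i j l : Fin n) :
    partialDeriv i (christoffel G' m j l) y = partialDeriv i (christoffel G m j l) y
      + (if m = j then 1 else 0) * partialDeriv i (partialDeriv l f) y
      + (if m = l then 1 else 0) * partialDeriv i (partialDeriv j f) y
      - (christoffelLower G l i j y + christoffelLower G j i l y) * gradient G f m y
      - G y j l * partialDeriv i (gradient G f m) y := by
  have hd₁ := differentiableAt_of_contDiffOn hG.isOpen (hG.contDiffOn_christoffel m j l) hy
  have hd₂ : ∀ a, DifferentiableAt ℝ (partialDeriv a f) y := fun a =>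
    differentiableAt_of_contDiffOn hG.isOpen (contDiffOn_partialDeriv hG.isOpen hf a) hy
  have hd₃ := differentiableAt_of_contDiffOn hG.isOpen (hG.contDiffOn_gradient hf m) hy
  have hd₄ := hG.differentiableAt hy j l
  rw [partialDeriv_congr hG.isOpen
      (fun z hz => hG.christoffel_conformal hf hG' hz m j l) hy i,
    partialDeriv_sub ((hd₁.fun_add ((hd₂ l).const_mul _)).fun_add ((hd₂ j).const_mul _))
      (hd₄.fun_mul hd₃),
    partialDeriv_add (hd₁.fun_add ((hd₂ l).const_mul _)) ((hd₂ j).const_mul _),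
    partialDeriv_add hd₁ ((hd₂ l).const_mul _), partialDeriv_const_mul (hd₂ l),
    partialDeriv_const_mul (hd₂ j), partialDeriv_mul hd₄ hd₃, hG.partialDeriv_metric hy]
  ring

/-- With Γ' = Γ + D for the difference tensor D, the groups on the right are ΓΓ, DΓ, ΓD and DD in
this order. -/
lemma sum_christoffel_mul_conformal (hG : IsMetricOn G U) (hf : ContDiffOn ℝ ∞ f U)
    (hG' : ∀ z ∈ U, G' z = Real.exp (2 * f z) • G z) (hy : y ∈ U) (m i j l : Fin n) :
    ∑ s, christoffel G' m i s y * christoffel G' s j l y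
      = ∑ s, christoffel G m i s y * christoffel G s j l y
        + ((if m = i then 1 else 0) * (∑ s, partialDeriv s f y * christoffel G s j l y)
          + partialDeriv i f y * christoffel G m j l y
          - gradient G f m y * christoffelLower G i j l y)
        + (christoffel G m i j y * partialDeriv l f y + christoffel G m i l y * partialDeriv j f y
          - G y j l * ∑ s, christoffel G m i s y * gradient G f s y)
        + ((if m = i then 1 else 0) *
            (2 * partialDeriv j f y * partialDeriv l f y - G y j l * gradientSq G f y)
          + partialDeriv i f y * ((if m = j then 1 else 0) * partialDeriv l f y
            + (if m = l then 1 else 0) * partialDeriv j f y - G y j l * gradient G f m y)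
          - gradient G f m y * (G y i j * partialDeriv l f y + G y i l * partialDeriv j f y
            - G y j l * partialDeriv i f y)) := by
  simp only [hG.christoffel_conformal hf hG' hy]
  rw [← hG.sum_mul_christoffel hy i j l]
  unfold gradientSq
  have hgr := hG.sum_mul_gradient (f := f) hy i
  have hterm : ∀ s, (christoffel G m i s y + (if m = i then 1 else 0) * partialDeriv s f y
      + (if m = s then 1 else 0) * partialDeriv i f y - G y i s * gradient G f m y)
      * (christoffel G s j l y + (if s = j then 1 else 0) * partialDeriv l f y
      + (if s = l then 1 else 0) * partialDeriv j f y - G y j l * gradient G f s y)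
      = christoffel G m i s y * christoffel G s j l y
        + (if m = i then 1 else 0) * (partialDeriv s f y * christoffel G s j l y)
        + (if m = s then partialDeriv i f y * christoffel G s j l y else 0)
        - gradient G f m y * (G y i s * christoffel G s j l y)
        + (if s = j then christoffel G m i s y * partialDeriv l f y else 0)
        + (if s = l then christoffel G m i s y * partialDeriv j f y else 0)
        - G y j l * (christoffel G m i s y * gradient G f s y)
        + (if s = j then (if m = i then 1 else 0) * partialDeriv s f y * partialDeriv l f y else 0)
        + (if s = l then (if m = i then 1 else 0) * partialDeriv s f y * partialDeriv j f y else 0)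
        - (if m = i then 1 else 0) * G y j l * (partialDeriv s f y * gradient G f s y)
        + (if m = s then partialDeriv i f y * ((if s = j then 1 else 0) * partialDeriv l f y
            + (if s = l then 1 else 0) * partialDeriv j f y - G y j l * gradient G f s y) else 0)
        - (if s = j then gradient G f m y * G y i s * partialDeriv l f y else 0)
        - (if s = l then gradient G f m y * G y i s * partialDeriv j f y else 0)
        + gradient G f m y * G y j l * (G y i s * gradient G f s y) := by
    intro s
    split_ifs <;> ring
  simp only [hterm, Finset.sum_add_distrib, Finset.sum_sub_distrib, Finset.sum_ite_eq,
    Finset.sum_ite_eq', Finset.mem_univ, if_true, ← Finset.mul_sum, hgr]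
  ring

/-- After antisymmetrizing in i and j, the non-tensorial terms assemble into the Hessian of f and
the covariant derivative of its gradient. -/
lemma curvatureUp_conformal (hG : IsMetricOn G U) (hf : ContDiffOn ℝ ∞ f U)
    (hG' : ∀ z ∈ U, G' z = Real.exp (2 * f z) • G z) (hy : y ∈ U) (m i j l : Fin n) :
    curvatureUp G' m i j l y = curvatureUp G m i j l y
      + (if m = j then 1 else 0) * (hessian G f i l y - partialDeriv i f y * partialDeriv l f y
        + gradientSq G f y * G y i l)
      - (if m = i then 1 else 0) * (hessian G f j l y - partialDeriv j f y * partialDeriv l f y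
        + gradientSq G f y * G y j l)
      - G y j l * (partialDeriv i (gradient G f m) y
          + ∑ s, christoffel G m i s y * gradient G f s y - partialDeriv i f y * gradient G f m y)
      + G y i l * (partialDeriv j (gradient G f m) y
          + ∑ s, christoffel G m j s y * gradient G f s y
          - partialDeriv j f y * gradient G f m y) := by
  unfold curvatureUp hessian
  simp only [Finset.sum_sub_distrib]
  rw [hG.partialDeriv_christoffel_conformal hf hG' hy, hG.partialDeriv_christoffel_conformal hf hG' hy,
    hG.sum_christoffel_mul_conformal hf hG' hy, hG.sum_christoffel_mul_conformal hf hG' hy,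
    partialDeriv_comm hG.isOpen hf hy j i, hG.christoffel_comm hy m j i,
    hG.christoffelLower_comm hy l j i, hG.symm y hy j i]
  ring

/-- The change of the curvature tensor under a conformal change of metric. -/
lemma riemann_conformal (hG : IsMetricOn G U) (hf : ContDiffOn ℝ ∞ f U)
    (hG' : ∀ z ∈ U, G' z = Real.exp (2 * f z) • G z) (hy : y ∈ U) (i j k l : Fin n) :
    riemann G' i j k l y = Real.exp (2 * f y) * (riemann G i j k l y
      - kulkarniNomizu (fun a b => schoutenChange G f a b y) (fun a b => G y a b) i j k l) := by
  have hδ : ∀ j, ∑ m, G y k m * (if m = j then 1 else 0) = G y k j := by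
    intro j; simp
  have hgr := hG.sum_mul_gradient (f := f) hy k
  have hn : ∀ i, ∑ m, G y k m * (partialDeriv i (gradient G f m) y
      + ∑ s, christoffel G m i s y * gradient G f s y
      - partialDeriv i f y * gradient G f m y)
      = hessian G f i k y - partialDeriv i f y * partialDeriv k f y := by
    intro i
    rw [← hG.sum_mul_nabla_gradient hf hy, ← hgr, Finset.mul_sum, ← Finset.sum_sub_distrib]
    exact Finset.sum_congr rfl fun m _ => by ring
  have hterm : ∀ m, G y k m * curvatureUp G' m i j l y = G y k m * curvatureUp G m i j l y
      + (G y k m * (if m = j then 1 else 0)) *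
        (hessian G f i l y - partialDeriv i f y * partialDeriv l f y + gradientSq G f y * G y i l)
      - (G y k m * (if m = i then 1 else 0)) *
        (hessian G f j l y - partialDeriv j f y * partialDeriv l f y + gradientSq G f y * G y j l)
      - G y j l * (G y k m * (partialDeriv i (gradient G f m) y
          + ∑ s, christoffel G m i s y * gradient G f s y - partialDeriv i f y * gradient G f m y))
      + G y i l * (G y k m * (partialDeriv j (gradient G f m) y
          + ∑ s, christoffel G m j s y * gradient G f s y
          - partialDeriv j f y * gradient G f m y)) := by
    intro m
    rw [hG.curvatureUp_conformal hf hG' hy]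
    ring
  have hsum : ∑ m, G y k m * curvatureUp G' m i j l y = riemann G i j k l y
      - kulkarniNomizu (fun a b => schoutenChange G f a b y) (fun a b => G y a b) i j k l := by
    simp only [hterm, Finset.sum_add_distrib, Finset.sum_sub_distrib, ← Finset.sum_mul,
      ← Finset.mul_sum, hδ, hn]
    -- The Kulkarni-Nomizu product of g with itself produces each term twice; this is the origin of
    -- the factor 1/2 before |df|² in `schoutenChange`.
    unfold riemann kulkarniNomizu schoutenChange
    rw [hG.symm y hy k j, hG.symm y hy k i]
    ring
  rw [← hsum, Finset.mul_sum]
  unfold riemann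
  refine Finset.sum_congr rfl fun m _ => ?_
  rw [hG' y hy]
  simp only [Matrix.smul_apply, smul_eq_mul]
  ring

end IsMetricOn

end ConformalChange

/-! ### Algebraic conformal invariance of the Weyl part -/

section WeylAlgebra

variable {n : ℕ}

/-- The Ricci contraction of a `4`-tensor with respect to the metric matrix `A`. -/
def ricciOf (A : Matrix (Fin n) (Fin n) ℝ) (r : Fin n → Fin n → Fin n → Fin n → ℝ)
    (i k : Fin n) : ℝ :=
  ∑ j, ∑ l, A⁻¹ j l * r i j k l

/-- The scalar contraction of a `4`-tensor with respect to the metric matrix `A`. -/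
def scalarOf (A : Matrix (Fin n) (Fin n) ℝ) (r : Fin n → Fin n → Fin n → Fin n → ℝ) : ℝ :=
  ∑ i, ∑ k, A⁻¹ i k * ricciOf A r i k

/-- The Schouten contraction of a `4`-tensor with respect to the metric matrix `A`. -/
def schoutenOf (A : Matrix (Fin n) (Fin n) ℝ) (r : Fin n → Fin n → Fin n → Fin n → ℝ)
    (i k : Fin n) : ℝ :=
  (1 / ((n : ℝ) - 2)) * (ricciOf A r i k - 1 / (2 * ((n : ℝ) - 1)) * scalarOf A r * A i k)

/-- The Weyl part of a `4`-tensor with respect to the metric matrix `A`. -/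
def weylOf (A : Matrix (Fin n) (Fin n) ℝ) (r : Fin n → Fin n → Fin n → Fin n → ℝ)
    (i j k l : Fin n) : ℝ :=
  r i j k l - kulkarniNomizu (schoutenOf A r) (fun a b => A a b) i j k l

lemma weyl_eq_weylOf (G : EuclideanSpace ℝ (Fin n) → Matrix (Fin n) (Fin n) ℝ) (i j k l : Fin n)
    (y : EuclideanSpace ℝ (Fin n)) :
    weyl G i j k l y = weylOf (G y) (fun i j k l => riemann G i j k l y) i j k l := rfl

variable {A : Matrix (Fin n) (Fin n) ℝ} {r : Fin n → Fin n → Fin n → Fin n → ℝ}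
  {T : Fin n → Fin n → ℝ} {c : ℝ}

lemma sum_sum_inv_mul_self (hA : IsUnit A.det) (hs : ∀ i j, A i j = A j i) :
    ∑ j, ∑ l, A⁻¹ j l * A j l = n := by
  have : ∀ j, ∑ l, A⁻¹ j l * A j l = 1 := fun j => by
    rw [Finset.sum_congr rfl fun l _ => by rw [hs j l], sum_inv_mul hA j j, if_pos rfl]
  simp [this]

lemma sum_sum_inv_mul_left (hA : IsUnit A.det) (hs : ∀ i j, A i j = A j i) (t : Fin n → ℝ)
    (k : Fin n) : ∑ j, ∑ l, A⁻¹ j l * (t l * A j k) = t k := by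
  rw [Finset.sum_comm]
  have : ∀ l, ∑ j, A⁻¹ j l * (t l * A j k) = if l = k then t l else 0 := fun l => by
    rw [← mul_boole, ← sum_inv_mul hA l k, Finset.mul_sum]
    exact Finset.sum_congr rfl fun j _ => by rw [inv_symm hs j l]; ring
  simp [this]

lemma sum_sum_inv_mul_right (hA : IsUnit A.det) (hs : ∀ i j, A i j = A j i) (t : Fin n → ℝ)
    (i : Fin n) : ∑ j, ∑ l, A⁻¹ j l * (t j * A i l) = t i := by
  have : ∀ j, ∑ l, A⁻¹ j l * (t j * A i l) = if j = i then t j else 0 := fun j => by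
    rw [← mul_boole, ← sum_inv_mul hA j i, Finset.mul_sum]
    exact Finset.sum_congr rfl fun l _ => by rw [hs i l]; ring
  simp [this]

/-- The constants in the Schouten tensor are chosen to invert this contraction, so that the Schouten
contraction of T ∧ g is T. -/
lemma ricciOf_kulkarniNomizu (hA : IsUnit A.det) (hs : ∀ i j, A i j = A j i) (i k : Fin n) :
    ricciOf A (kulkarniNomizu T (fun a b => A a b)) i k
      = ((n : ℝ) - 2) * T i k + (∑ j, ∑ l, A⁻¹ j l * T j l) * A i k := by
  have h1 := sum_sum_inv_mul_self hA hs
  have h2 := sum_sum_inv_mul_left hA hs (T i) k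
  have h3 := sum_sum_inv_mul_right hA hs (fun j => T j k) i
  have hterm : ∀ j l, A⁻¹ j l * kulkarniNomizu T (fun a b => A a b) i j k l
      = A⁻¹ j l * A j l * T i k + A⁻¹ j l * T j l * A i k - A⁻¹ j l * (T i l * A j k)
        - A⁻¹ j l * (T j k * A i l) := by
    intro j l
    unfold kulkarniNomizu
    ring
  unfold ricciOf
  simp only [hterm, Finset.sum_sub_distrib, Finset.sum_add_distrib, ← Finset.sum_mul, h1, h2, h3]
  ring

lemma ricciOf_conformal (hA : IsUnit A.det) (hs : ∀ i j, A i j = A j i) (hc : c ≠ 0)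
    (i k : Fin n) :
    ricciOf (c • A) (fun i j k l => c * (r i j k l - kulkarniNomizu T (fun a b => A a b) i j k l))
        i k
      = ricciOf A r i k
        - (((n : ℝ) - 2) * T i k + (∑ j, ∑ l, A⁻¹ j l * T j l) * A i k) := by
  rw [← ricciOf_kulkarniNomizu hA hs]
  unfold ricciOf
  rw [inv_smul_of_isUnit_det hc hA]
  simp only [← Finset.sum_sub_distrib, Matrix.smul_apply, smul_eq_mul]
  refine Finset.sum_congr rfl fun j _ => Finset.sum_congr rfl fun l _ => ?_
  field_simp

lemma scalarOf_conformal (hA : IsUnit A.det) (hs : ∀ i j, A i j = A j i) (hc : c ≠ 0) :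
    scalarOf (c • A) (fun i j k l => c * (r i j k l - kulkarniNomizu T (fun a b => A a b) i j k l))
      = c⁻¹ * (scalarOf A r - 2 * ((n : ℝ) - 1) * (∑ j, ∑ l, A⁻¹ j l * T j l)) := by
  have h1 := sum_sum_inv_mul_self hA hs
  set t := ∑ j, ∑ l, A⁻¹ j l * T j l with ht
  have hterm : ∀ i k, (c • A)⁻¹ i k * ricciOf (c • A)
      (fun i j k l => c * (r i j k l - kulkarniNomizu T (fun a b => A a b) i j k l)) i k
      = c⁻¹ * (A⁻¹ i k * ricciOf A r i k) - c⁻¹ * ((n : ℝ) - 2) * (A⁻¹ i k * T i k)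
        - c⁻¹ * t * (A⁻¹ i k * A i k) := by
    intro i k
    rw [ricciOf_conformal hA hs hc, inv_smul_of_isUnit_det hc hA, ← ht]
    simp only [Matrix.smul_apply, smul_eq_mul]
    ring
  unfold scalarOf
  simp only [hterm, Finset.sum_sub_distrib, ← Finset.mul_sum, h1, ← ht]
  ring

/-- The Weyl part is conformally invariant. -/
lemma weylOf_conformal (hn : 3 ≤ n) (hA : IsUnit A.det) (hs : ∀ i j, A i j = A j i) (hc : c ≠ 0)
    (i j k l : Fin n) :
    weylOf (c • A) (fun i j k l => c * (r i j k l - kulkarniNomizu T (fun a b => A a b) i j k l))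
        i j k l = c * weylOf A r i j k l := by
  have hn' : (3 : ℝ) ≤ n := by exact_mod_cast hn
  have h2 : (n : ℝ) - 2 ≠ 0 := by linarith
  have h1 : (n : ℝ) - 1 ≠ 0 := by linarith
  -- The Schouten contraction recovers T from T ∧ g, so it drops by exactly T and the correction to
  -- R cancels in the Weyl part. The bound on n keeps both denominators non-zero.
  have hS : schoutenOf (c • A)
      (fun i j k l => c * (r i j k l - kulkarniNomizu T (fun a b => A a b) i j k l))
      = fun a b => schoutenOf A r a b - T a b := by
    funext a b
    unfold schoutenOf
    rw [ricciOf_conformal hA hs hc, scalarOf_conformal hA hs hc]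
    simp only [Matrix.smul_apply, smul_eq_mul]
    field_simp
    ring
  unfold weylOf
  rw [hS]
  unfold kulkarniNomizu
  simp only [Matrix.smul_apply, smul_eq_mul]
  ring

end WeylAlgebra

/-! ### Contracting the Weyl tensor with a curvature-null vector -/

section WeylContraction

variable {n : ℕ} {G : EuclideanSpace ℝ (Fin n) → Matrix (Fin n) (Fin n) ℝ}
  {U : Set (EuclideanSpace ℝ (Fin n))} {y : EuclideanSpace ℝ (Fin n)} {v : Fin n → ℝ}

lemma weyl_swap (i j k l : Fin n) : weyl G j i k l y = - weyl G i j k l y := by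
  unfold weyl kulkarniNomizu
  rw [IsMetricOn.riemann_swap]
  ring

variable (G) in
/-- The normalized scalar curvature `s / (2 (n - 1) (n - 2))`. -/
def normalizedScalar (y : EuclideanSpace ℝ (Fin n)) : ℝ :=
  1 / ((n : ℝ) - 2) * (1 / (2 * ((n : ℝ) - 1)) * scalarCurvature G y)

variable (G) in
/-- The symmetric form `σ g - S`, where `σ` is the normalized scalar curvature and `S` the Schouten
tensor. -/
def weylForm (y : EuclideanSpace ℝ (Fin n)) : Matrix (Fin n) (Fin n) ℝ :=
  Matrix.of fun i j => normalizedScalar G y * G y i j - schouten G i j y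

namespace IsMetricOn

lemma weylForm_symm (hG : IsMetricOn G U) (hy : y ∈ U) (i j : Fin n) :
    weylForm G y i j = weylForm G y j i := by
  simp only [weylForm, Matrix.of_apply]
  rw [hG.symm y hy, hG.schouten_symm hy]

/-- A vector annihilated by the curvature is annihilated by the Ricci tensor. -/
lemma sum_ricci_mul_eq_zero (hG : IsMetricOn G U) (hy : y ∈ U)
    (hv : ∀ i j k, ∑ l, riemann G i j k l y * v l = 0) (k : Fin n) :
    ∑ i, ricci G i k y * v i = 0 := by
  -- The vector is null in the last slot by hypothesis; pair symmetry and antisymmetry carry it to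
  -- the first.
  have h : ∀ j k l, ∑ i, riemann G i j k l y * v i = 0 := by
    intro j k l
    rw [← neg_eq_zero, ← Finset.sum_neg_distrib, ← hv k l j]
    refine Finset.sum_congr rfl fun i _ => ?_
    rw [riemann_swap j i, hG.riemann_pair_symm hy]
    ring
  unfold ricci
  simp only [Finset.sum_mul]
  rw [Finset.sum_comm]
  refine Finset.sum_eq_zero fun j _ => ?_
  rw [Finset.sum_comm]
  refine Finset.sum_eq_zero fun l _ => ?_
  simp only [mul_assoc, ← Finset.mul_sum, h, mul_zero]

lemma sum_schouten_mul (hG : IsMetricOn G U) (hy : y ∈ U)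
    (hv : ∀ i j k, ∑ l, riemann G i j k l y * v l = 0) (k : Fin n) :
    ∑ i, schouten G i k y * v i = - (normalizedScalar G y * ∑ i, G y i k * v i) := by
  have h := hG.sum_ricci_mul_eq_zero hy hv k
  have hterm : ∀ i, schouten G i k y * v i = 1 / ((n : ℝ) - 2) * (ricci G i k y * v i)
      - normalizedScalar G y * (G y i k * v i) := by
    intro i
    unfold schouten normalizedScalar
    ring
  simp only [hterm, Finset.sum_sub_distrib, ← Finset.mul_sum, h]
  ring

/-- Since v is an eigenvector of S with eigenvalue -σ, it is one of σg - S with eigenvalue 2σ. This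
is why v^⊥ is preserved. -/
lemma sum_weylForm_mul (hG : IsMetricOn G U) (hy : y ∈ U)
    (hv : ∀ i j k, ∑ l, riemann G i j k l y * v l = 0) (k : Fin n) :
    ∑ i, weylForm G y i k * v i = 2 * normalizedScalar G y * ∑ i, G y i k * v i := by
  have h := hG.sum_schouten_mul hy hv k
  simp only [weylForm, Matrix.of_apply, sub_mul, Finset.sum_sub_distrib, h, mul_assoc,
    ← Finset.mul_sum]
  ring

/-- The contraction of the Weyl tensor with a vector annihilated by the curvature. -/
lemma sum_weyl_mul (hG : IsMetricOn G U) (hy : y ∈ U)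
    (hv : ∀ i j k, ∑ l, riemann G i j k l y * v l = 0) (w : Fin n → ℝ) (a b : Fin n) :
    ∑ i, ∑ j, weyl G i j a b y * (v i * w j)
      = (∑ i, G y i a * v i) * (∑ j, weylForm G y j b * w j)
        - (∑ i, G y i b * v i) * (∑ j, weylForm G y j a * w j) := by
  have hR : ∑ i, ∑ j, riemann G i j a b y * (v i * w j) = 0 := by
    rw [Finset.sum_comm]
    refine Finset.sum_eq_zero fun j _ => ?_
    have h : ∑ i, riemann G i j a b y * (v i * w j)
        = - w j * ∑ i, riemann G a b j i y * v i := by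
      rw [Finset.mul_sum]
      refine Finset.sum_congr rfl fun i _ => ?_
      rw [riemann_swap j i, hG.riemann_pair_symm hy]
      ring
    rw [h, hv, mul_zero]
  -- Two of the four Kulkarni-Nomizu terms contract S with v and become multiples of σg; joined to
  -- the other two, they turn -S into σg - S.
  have hSa := hG.sum_schouten_mul hy hv a
  have hSb := hG.sum_schouten_mul hy hv b
  have hterm : ∀ i j, weyl G i j a b y * (v i * w j) = riemann G i j a b y * (v i * w j)
      - (schouten G i a y * v i) * (G y j b * w j) - (G y i a * v i) * (schouten G j b y * w j)
      + (schouten G i b y * v i) * (G y j a * w j)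
      + (G y i b * v i) * (schouten G j a y * w j) := by
    intro i j
    unfold weyl kulkarniNomizu
    ring
  simp only [hterm, Finset.sum_add_distrib, Finset.sum_sub_distrib, ← Finset.mul_sum,
    ← Finset.sum_mul, hR, hSa, hSb]
  simp only [weylForm, Matrix.of_apply, sub_mul, Finset.sum_sub_distrib, mul_assoc,
    ← Finset.mul_sum]
  ring

end IsMetricOn

end WeylContraction

/-! ### Diagonalization of self-adjoint endomorphisms -/

section Spectral

/-- An endomorphism of a finite-dimensional real vector space which is self-adjoint for some inner
product has a basis of eigenvectors. -/
lemma exists_linearIndependent_eigenvectors {V : Type*} [AddCommGroup V] [Module ℝ V]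
    [FiniteDimensional ℝ V] (B : V →ₗ[ℝ] V →ₗ[ℝ] ℝ) (hsymm : ∀ x y, B x y = B y x)
    (hpos : ∀ x, x ≠ 0 → 0 < B x x) (A : V →ₗ[ℝ] V) (hA : ∀ x y, B (A x) y = B x (A y))
    {m : ℕ} (hm : Module.finrank ℝ V = m) :
    ∃ b : Fin m → V, LinearIndependent ℝ b ∧ ∀ i, ∃ μ : ℝ, A (b i) = μ • b i := by
  -- `B` is installed as the inner product, so that the spectral theorem applies to `A`.
  let core : InnerProductSpace.Core ℝ V :=
    { inner := fun x y => B x y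
      conj_inner_symm := fun x y => hsymm y x
      re_inner_nonneg := fun x => by
        by_cases hx : x = 0
        · simp [hx]
        · exact (hpos x hx).le
      add_left := fun x y z => by simp
      smul_left := fun x y c => by simp
      definite := fun x hx => by
        by_contra h
        exact (hpos x h).ne' hx }
  let _ : NormedAddCommGroup V := core.toNormedAddCommGroup
  let _ : InnerProductSpace ℝ V := InnerProductSpace.ofCore core.toCore
  have hT : A.IsSymmetric := hA
  exact ⟨hT.eigenvectorBasis hm, (hT.eigenvectorBasis hm).orthonormal.linearIndependent,
    fun i => ⟨hT.eigenvalues hm i, hT.apply_eigenvectorBasis hm i⟩⟩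

end Spectral

/-! ### Bivectors and their coordinates -/

section Bivectors

variable {n : ℕ} {M : Type*} [TopologicalSpace M] [ChartedSpace (EuclideanSpace ℝ (Fin n)) M]
  {p : M}

lemma wedge_swap (x y : TangentSpace (𝓡 n) p) : wedge x y = - wedge y x := by
  unfold wedge
  rw [← AlternatingMap.map_swap _ _ (show (0 : Fin 2) ≠ 1 by decide)]
  congr 1
  ext i
  fin_cases i <;> rfl

lemma wedge_add_left (x y z : TangentSpace (𝓡 n) p) :
    wedge (x + y) z = wedge x z + wedge y z :=
  AlternatingMap.map_vecCons_add _ _ _ _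

lemma wedge_smul_left (c : ℝ) (x z : TangentSpace (𝓡 n) p) :
    wedge (c • x) z = c • wedge x z :=
  AlternatingMap.map_vecCons_smul _ _ _ _

variable (p) in
/-- The wedge product as a bilinear map. -/
def wedgeHom : TangentSpace (𝓡 n) p →ₗ[ℝ] TangentSpace (𝓡 n) p →ₗ[ℝ] Bivector n p :=
  LinearMap.mk₂ ℝ wedge wedge_add_left wedge_smul_left
    (fun x y z => by
      rw [wedge_swap, wedge_add_left, wedge_swap x y, wedge_swap x z, neg_add])
    (fun c x y => by
      rw [wedge_swap, wedge_smul_left, wedge_swap x y, smul_neg])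

lemma wedgeHom_apply (x y : TangentSpace (𝓡 n) p) : wedgeHom p x y = wedge x y := rfl

lemma eq_sum_tangentCoord (v : TangentSpace (𝓡 n) p) :
    v = ∑ k, tangentCoord n p k v • tangentBasis n p k := by
  have hu : ∀ u : EuclideanSpace ℝ (Fin n),
      u = ∑ k, u k • (EuclideanSpace.single k 1 : EuclideanSpace ℝ (Fin n)) := by
    intro u
    ext j
    simp [Finset.sum_apply, Pi.single_apply]
  exact hu v

lemma tangentCoord_ext {v w : TangentSpace (𝓡 n) p}
    (h : ∀ k, tangentCoord n p k v = tangentCoord n p k w) : v = w := by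
  rw [eq_sum_tangentCoord v, eq_sum_tangentCoord w]
  simp only [h]

lemma wedge_eq_sum (v w : TangentSpace (𝓡 n) p) :
    wedge v w = ∑ k, ∑ l, (tangentCoord n p k v * tangentCoord n p l w) •
      wedge (tangentBasis n p k) (tangentBasis n p l) := by
  conv_lhs => rw [← wedgeHom_apply, eq_sum_tangentCoord v, eq_sum_tangentCoord w]
  simp only [map_sum, map_smul, LinearMap.sum_apply, LinearMap.smul_apply, wedgeHom_apply,
    Finset.smul_sum, smul_smul]
  rw [Finset.sum_comm]
  exact Finset.sum_congr rfl fun k _ => Finset.sum_congr rfl fun l _ => by rw [mul_comm]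

lemma bivectorCoord_wedge (i j : Fin n) (v w : TangentSpace (𝓡 n) p) :
    bivectorCoord n p i j (wedge v w) = tangentCoord n p i v * tangentCoord n p j w
      - tangentCoord n p j v * tangentCoord n p i w := by
  unfold bivectorCoord wedge
  rw [exteriorPower.pairingDual_ιMulti_ιMulti, Matrix.det_fin_two]
  simp

/-- If `v ∧ w = 0` and `v ≠ 0`, then `w` is a multiple of `v`. -/
lemma exists_eq_smul_of_wedge_eq_zero {v w : TangentSpace (𝓡 n) p} (hv : v ≠ 0)
    (h : wedge v w = 0) : ∃ c : ℝ, w = c • v := by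
  obtain ⟨i, hi⟩ : ∃ i, tangentCoord n p i v ≠ 0 := by
    by_contra! hall
    exact hv (tangentCoord_ext fun k => by rw [hall k, map_zero])
  refine ⟨tangentCoord n p i w / tangentCoord n p i v, tangentCoord_ext fun j => ?_⟩
  have hij := bivectorCoord_wedge i j v w
  rw [h, map_zero] at hij
  rw [map_smul, smul_eq_mul]
  field_simp
  linarith

lemma tangentCoord_tangentBasis (p : M) (i j : Fin n) :
    tangentCoord n p i (tangentBasis n p j) = if i = j then 1 else 0 := by
  change (EuclideanSpace.single j (1 : ℝ) : EuclideanSpace ℝ (Fin n)) i = _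
  simp

end Bivectors

/-! ### The Weyl operator and its action on simple bivectors -/

section WeylOperator

lemma sum_sum_sum_sum_comm {ι N : Type*} [Fintype ι] [AddCommMonoid N] (F : ι → ι → ι → ι → N) :
    ∑ a, ∑ b, ∑ i, ∑ j, F a b i j = ∑ i, ∑ j, ∑ a, ∑ b, F a b i j := by
  calc ∑ a, ∑ b, ∑ i, ∑ j, F a b i j
      = ∑ a, ∑ i, ∑ j, ∑ b, F a b i j := by
        refine Finset.sum_congr rfl fun a _ => ?_
        rw [Finset.sum_comm]
        exact Finset.sum_congr rfl fun i _ => Finset.sum_comm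
    _ = _ := by
        rw [Finset.sum_comm]
        exact Finset.sum_congr rfl fun i _ => Finset.sum_comm

variable {n : ℕ} {M : Type*} [TopologicalSpace M] [ChartedSpace (EuclideanSpace ℝ (Fin n)) M]
  [IsManifold (𝓡 n) ∞ M]

lemma isMetricOn_metricInChart (g : SmoothMetric n M) (p : M) :
    IsMetricOn (metricInChart g p) (extChartAt (𝓡 n) p).target where
  isOpen := isOpen_target p
  contDiffOn := contDiffOn_metricInChart g p
  symm := fun y _ => metricInChart_symm g p y
  isUnit_det := fun _ hy => isUnit_det_metricInChart g p hy

lemma inner_eq_sum_tangentCoord (g : SmoothMetric n M) (p : M) (v w : TangentSpace (𝓡 n) p) :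
    g.inner p v w = ∑ i, ∑ j, metricInChart g p (extChartAt (𝓡 n) p p) i j
      * tangentCoord n p i v * tangentCoord n p j w :=
  inner_eq_sum g p v w

/-- The conformal covariance of the Weyl operator. -/
lemma weylOperator_conformal (hn : 3 ≤ n) {g g' : SmoothMetric n M} {f : M → ℝ}
    (hf : ContMDiff (𝓡 n) 𝓘(ℝ, ℝ) ∞ f)
    (h : ∀ (p : M) (v w : TangentSpace (𝓡 n) p),
      g'.inner p v w = Real.exp (2 * f p) * g.inner p v w) (p : M) :
    ∃ c : ℝ, weylOperator g' p = c • weylOperator g p := by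
  set y := extChartAt (𝓡 n) p p with hydef
  have hy : y ∈ (extChartAt (𝓡 n) p).target := mem_extChartAt_target p
  have hG := isMetricOn_metricInChart g p
  let φ : EuclideanSpace ℝ (Fin n) → ℝ := fun z => f ((extChartAt (𝓡 n) p).symm z)
  have hφ : ContDiffOn ℝ ∞ φ (extChartAt (𝓡 n) p).target :=
    contMDiffOn_iff_contDiffOn.mp (hf.comp_contMDiffOn (contMDiffOn_symm p))
  have hG' : ∀ z ∈ (extChartAt (𝓡 n) p).target,
      metricInChart g' p z = Real.exp (2 * φ z) • metricInChart g p z := by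
    intro z _
    ext i j
    exact h _ _ _
  have hne : Real.exp (2 * φ y) ≠ 0 := (Real.exp_pos _).ne'
  have hinv : ∀ a b, inverseMetricAt g' p a b
      = (Real.exp (2 * φ y))⁻¹ * inverseMetricAt g p a b := by
    intro a b
    unfold inverseMetricAt
    rw [← hydef, hG' y hy, inv_smul_of_isUnit_det hne (hG.isUnit_det y hy)]
    rfl
  have hW : ∀ i j k l, weylAt g' p i j k l = Real.exp (2 * φ y) * weylAt g p i j k l := by
    intro i j k l
    unfold weylAt
    rw [← hydef, weyl_eq_weylOf, weyl_eq_weylOf, hG' y hy]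
    simp only [hG.riemann_conformal hφ hG' hy]
    exact weylOf_conformal hn (hG.isUnit_det y hy) (hG.symm y hy) hne i j k l
  -- The (0,4) tensor contributes e^{2f} and each of the two raised indices e^{-2f}.
  refine ⟨(Real.exp (2 * φ y))⁻¹, ?_⟩
  unfold weylOperator
  simp only [Finset.smul_sum, smul_smul]
  refine Finset.sum_congr rfl fun i _ => Finset.sum_congr rfl fun j _ =>
    Finset.sum_congr rfl fun k _ => Finset.sum_congr rfl fun l _ => ?_
  congr 1
  simp only [Finset.mul_sum, hW, hinv]
  refine Finset.sum_congr rfl fun a _ => Finset.sum_congr rfl fun b _ => ?_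
  field_simp

/-- The endomorphism of `T_p M` associated by the metric to the form `σ g - S`. -/
def weylEndomorphism (g : SmoothMetric n M) (p : M) : Module.End ℝ (TangentSpace (𝓡 n) p) :=
  ∑ l, ∑ j, (∑ b, inverseMetricAt g p l b * weylForm (metricInChart g p) (extChartAt (𝓡 n) p p) b j)
    • (tangentCoord n p j).smulRight (tangentBasis n p l)

lemma tangentCoord_weylEndomorphism (g : SmoothMetric n M) (p : M) (l : Fin n)
    (w : TangentSpace (𝓡 n) p) :
    tangentCoord n p l (weylEndomorphism g p w) = ∑ b, inverseMetricAt g p l b *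
      ∑ j, weylForm (metricInChart g p) (extChartAt (𝓡 n) p p) b j * tangentCoord n p j w := by
  unfold weylEndomorphism
  simp only [LinearMap.sum_apply, LinearMap.smul_apply, LinearMap.smulRight_apply, map_sum,
    map_smul, tangentCoord_tangentBasis, smul_eq_mul, mul_ite, mul_one, mul_zero]
  rw [Finset.sum_comm]
  simp only [Finset.sum_ite_eq, Finset.mem_univ, if_true, Finset.sum_mul, Finset.mul_sum]
  rw [Finset.sum_comm]
  exact Finset.sum_congr rfl fun b _ => Finset.sum_congr rfl fun j _ => by ring

lemma inner_weylEndomorphism (g : SmoothMetric n M) (p : M) (v w : TangentSpace (𝓡 n) p) :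
    g.inner p v (weylEndomorphism g p w) = ∑ i, ∑ j,
      weylForm (metricInChart g p) (extChartAt (𝓡 n) p p) i j
        * tangentCoord n p i v * tangentCoord n p j w := by
  have hG := isMetricOn_metricInChart g p
  have hy := mem_extChartAt_target (I := 𝓡 n) p
  rw [inner_eq_sum_tangentCoord]
  refine Finset.sum_congr rfl fun i _ => ?_
  have h := sum_mul_sum_inv (hG.isUnit_det _ hy) (fun b => ∑ j,
    weylForm (metricInChart g p) (extChartAt (𝓡 n) p p) b j * tangentCoord n p j w) i
  simp only [tangentCoord_weylEndomorphism, inverseMetricAt, mul_right_comm _ (tangentCoord n p i v),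
    ← Finset.sum_mul, h]

lemma inner_weylEndomorphism_comm (g : SmoothMetric n M) (p : M) (v w : TangentSpace (𝓡 n) p) :
    g.inner p (weylEndomorphism g p v) w = g.inner p v (weylEndomorphism g p w) := by
  have hG := isMetricOn_metricInChart g p
  have hy := mem_extChartAt_target (I := 𝓡 n) p
  rw [g.symm, inner_weylEndomorphism, inner_weylEndomorphism, Finset.sum_comm]
  refine Finset.sum_congr rfl fun i _ => Finset.sum_congr rfl fun j _ => ?_
  rw [hG.weylForm_symm hy]
  ring

/-- A tangent vector annihilated by the curvature tensor of `g`. -/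
def IsCurvatureNull (g : SmoothMetric n M) (p : M) (v : TangentSpace (𝓡 n) p) : Prop :=
  ∀ i j k, ∑ l, riemann (metricInChart g p) i j k l (extChartAt (𝓡 n) p p)
    * tangentCoord n p l v = 0

/-- By symmetry of the form and `sum_weylForm_mul`, the left side is 2σ g(v, w). -/
lemma IsCurvatureNull.inner_weylEndomorphism {g : SmoothMetric n M} {p : M}
    {v w : TangentSpace (𝓡 n) p} (hv : IsCurvatureNull g p v) (hw : g.inner p v w = 0) :
    g.inner p v (weylEndomorphism g p w) = 0 := by
  have hG := isMetricOn_metricInChart g p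
  have hy := mem_extChartAt_target (I := 𝓡 n) p
  rw [ConformalWeyl.inner_weylEndomorphism, Finset.sum_comm]
  rw [inner_eq_sum_tangentCoord, Finset.sum_comm] at hw
  simp only [← Finset.sum_mul] at hw ⊢
  simp only [hG.sum_weylForm_mul hy hv, mul_assoc, ← Finset.mul_sum] at hw ⊢
  rw [hw]
  simp

/-- Antisymmetry of W in its first pair merges the two terms of the coordinate of v ∧ w, which turns
the coefficient 1/4 into 1/2. -/
lemma weylOperator_wedge (g : SmoothMetric n M) (p : M) (v w : TangentSpace (𝓡 n) p) :
    weylOperator g p (wedge v w) = ∑ k, ∑ l, ((1 / 2) * ∑ a, ∑ b,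
      (∑ i, ∑ j, weylAt g p i j a b * (tangentCoord n p i v * tangentCoord n p j w))
        * inverseMetricAt g p a k * inverseMetricAt g p b l) •
      wedge (tangentBasis n p k) (tangentBasis n p l) := by
  have hanti : ∀ a b, ∑ i, ∑ j, weylAt g p i j a b * bivectorCoord n p i j (wedge v w)
      = 2 * ∑ i, ∑ j, weylAt g p i j a b * (tangentCoord n p i v * tangentCoord n p j w) := by
    intro a b
    have h : ∑ i, ∑ j, weylAt g p i j a b * (tangentCoord n p j v * tangentCoord n p i w)
        = - ∑ i, ∑ j, weylAt g p i j a b * (tangentCoord n p i v * tangentCoord n p j w) := by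
      rw [Finset.sum_comm, ← Finset.sum_neg_distrib]
      refine Finset.sum_congr rfl fun i _ => ?_
      rw [← Finset.sum_neg_distrib]
      refine Finset.sum_congr rfl fun j _ => ?_
      unfold weylAt
      rw [weyl_swap]
      ring
    simp only [bivectorCoord_wedge, mul_sub, Finset.sum_sub_distrib, h]
    ring
  have hcoef : ∀ k l, (1 / 2) * ∑ a, ∑ b,
      (∑ i, ∑ j, weylAt g p i j a b * (tangentCoord n p i v * tangentCoord n p j w))
        * inverseMetricAt g p a k * inverseMetricAt g p b l
      = ∑ i, ∑ j, ((1 / 4) * ∑ a, ∑ b,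
          weylAt g p i j a b * inverseMetricAt g p a k * inverseMetricAt g p b l)
          * bivectorCoord n p i j (wedge v w) := by
    intro k l
    have e : ∀ a b, (∑ i, ∑ j, weylAt g p i j a b *
          (tangentCoord n p i v * tangentCoord n p j w))
        * inverseMetricAt g p a k * inverseMetricAt g p b l
        = ∑ i, ∑ j, (1 / 2) * (weylAt g p i j a b * inverseMetricAt g p a k
          * inverseMetricAt g p b l * bivectorCoord n p i j (wedge v w)) := by
      intro a b
      have h2 : ∑ i, ∑ j, weylAt g p i j a b * (tangentCoord n p i v * tangentCoord n p j w)
          = (1 / 2) * ∑ i, ∑ j, weylAt g p i j a b * bivectorCoord n p i j (wedge v w) := by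
        rw [hanti]; ring
      rw [h2]
      simp only [Finset.mul_sum, Finset.sum_mul]
      exact Finset.sum_congr rfl fun i _ => Finset.sum_congr rfl fun j _ => by ring
    simp only [e]
    rw [sum_sum_sum_sum_comm]
    simp only [Finset.mul_sum, Finset.sum_mul]
    refine Finset.sum_congr rfl fun i _ => Finset.sum_congr rfl fun j _ =>
      Finset.sum_congr rfl fun a _ => Finset.sum_congr rfl fun b _ => ?_
    ring
  simp only [hcoef]
  unfold weylOperator
  simp only [LinearMap.sum_apply, LinearMap.smul_apply, LinearMap.smulRight_apply, smul_smul,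
    Finset.sum_smul]
  rw [sum_sum_sum_sum_comm]

/-- Raising both indices in `sum_weyl_mul` gives the components of v ∧ Φw; the remaining 1/2
compensates for summing over ordered pairs of basis vectors. No orthogonality of w is needed here.
-/
lemma IsCurvatureNull.weylOperator_wedge {g : SmoothMetric n M} {p : M}
    {v : TangentSpace (𝓡 n) p} (hv : IsCurvatureNull g p v) (w : TangentSpace (𝓡 n) p) :
    weylOperator g p (wedge v w) = wedge v (weylEndomorphism g p w) := by
  have hG := isMetricOn_metricInChart g p
  have hy := mem_extChartAt_target (I := 𝓡 n) p
  have hraise : ∀ k, ∑ a, (∑ i, metricInChart g p (extChartAt (𝓡 n) p p) i a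
      * tangentCoord n p i v) * inverseMetricAt g p a k = tangentCoord n p k v := by
    intro k
    simp only [Finset.sum_mul, mul_right_comm _ (tangentCoord n p _ v)]
    rw [Finset.sum_comm]
    simp only [← Finset.sum_mul, inverseMetricAt, sum_mul_inv (hG.isUnit_det _ hy)]
    simp
  have hraise' : ∀ l, ∑ b, (∑ j, weylForm (metricInChart g p) (extChartAt (𝓡 n) p p) j b
      * tangentCoord n p j w) * inverseMetricAt g p b l
      = tangentCoord n p l (weylEndomorphism g p w) := by
    intro l
    rw [tangentCoord_weylEndomorphism]
    refine Finset.sum_congr rfl fun b _ => ?_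
    rw [mul_comm]
    unfold inverseMetricAt
    rw [inv_symm (hG.symm _ hy)]
    simp only [hG.weylForm_symm hy b]
  have hcoef : ∀ k l, ∑ a, ∑ b,
      (∑ i, ∑ j, weylAt g p i j a b * (tangentCoord n p i v * tangentCoord n p j w))
        * inverseMetricAt g p a k * inverseMetricAt g p b l
      = tangentCoord n p k v * tangentCoord n p l (weylEndomorphism g p w)
        - tangentCoord n p l v * tangentCoord n p k (weylEndomorphism g p w) := by
    intro k l
    rw [← hraise k, ← hraise l, ← hraise' k, ← hraise' l, Finset.sum_mul_sum,
      mul_comm (∑ a, _) (∑ b, (∑ j, _ * _) * inverseMetricAt g p b k), Finset.sum_mul_sum,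
      ← Finset.sum_sub_distrib]
    refine Finset.sum_congr rfl fun a _ => ?_
    rw [← Finset.sum_sub_distrib]
    refine Finset.sum_congr rfl fun b _ => ?_
    unfold weylAt
    rw [hG.sum_weyl_mul hy hv]
    ring
  rw [ConformalWeyl.weylOperator_wedge]
  simp only [hcoef]
  have hflip : ∑ k, ∑ l, (tangentCoord n p l v * tangentCoord n p k (weylEndomorphism g p w)) •
      wedge (tangentBasis n p k) (tangentBasis n p l)
      = - wedge v (weylEndomorphism g p w) := by
    rw [← wedge_swap, wedge_eq_sum]
    exact Finset.sum_congr rfl fun k _ => Finset.sum_congr rfl fun l _ => by rw [mul_comm]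
  have hsplit : ∀ k l, ((1 / 2 : ℝ) *
      (tangentCoord n p k v * tangentCoord n p l (weylEndomorphism g p w)
        - tangentCoord n p l v * tangentCoord n p k (weylEndomorphism g p w))) •
        wedge (tangentBasis n p k) (tangentBasis n p l)
      = (1 / 2 : ℝ) • ((tangentCoord n p k v * tangentCoord n p l (weylEndomorphism g p w)) •
          wedge (tangentBasis n p k) (tangentBasis n p l)
        - (tangentCoord n p l v * tangentCoord n p k (weylEndomorphism g p w)) •
          wedge (tangentBasis n p k) (tangentBasis n p l)) := by
    intro k l
    rw [mul_smul, sub_smul]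
  simp only [hsplit, ← Finset.smul_sum, Finset.sum_sub_distrib]
  rw [← wedge_eq_sum, hflip]
  module

end WeylOperator

/-! ### Parallel fields on the manifold -/

section ParallelVector

variable {n : ℕ} {M : Type*} [TopologicalSpace M] [ChartedSpace (EuclideanSpace ℝ (Fin n)) M]
  [IsManifold (𝓡 n) ∞ M] {g : SmoothMetric n M} {X : ∀ q : M, TangentSpace (𝓡 n) q}

lemma fderiv_eq_zero_of_partialDeriv {f : EuclideanSpace ℝ (Fin n) → ℝ}
    {y : EuclideanSpace ℝ (Fin n)} (h : ∀ i, partialDeriv i f y = 0) : fderiv ℝ f y = 0 := by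
  ext u
  have hu : u = ∑ k, u k • (EuclideanSpace.single k 1 : EuclideanSpace ℝ (Fin n)) := by
    ext j
    simp [Finset.sum_apply, Pi.single_apply]
  rw [hu]
  have h' : ∀ i, fderiv ℝ f y (EuclideanSpace.single i 1) = 0 := h
  simp [map_sum, h']

lemma IsParallel.isLocallyConstant (hX : IsSmoothVectorField X) (hpar : IsParallel g X) :
    IsLocallyConstant (fun q => g.inner q (X q) (X q)) := by
  rw [IsLocallyConstant.iff_eventually_eq]
  intro p
  have hG := isMetricOn_metricInChart g p
  have hXc := contDiffOn_fieldInChart hX p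
  have hy := mem_extChartAt_target (I := 𝓡 n) p
  -- The chart image may be disconnected; a ball inside it is connected, so a vanishing derivative
  -- forces constancy there.
  obtain ⟨ε, hε, hball⟩ := Metric.isOpen_iff.mp hG.isOpen _ hy
  let F : EuclideanSpace ℝ (Fin n) → ℝ := fun z =>
    ∑ i, ∑ j, metricInChart g p z i j * fieldInChart X p i z * fieldInChart X p j z
  have hF : ContDiffOn ℝ ∞ F (extChartAt (𝓡 n) p).target :=
    ContDiffOn.sum fun i _ => ContDiffOn.sum fun j _ =>
      ((hG.contDiffOn i j).mul (hXc i)).mul (hXc j)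
  have hconst : ∀ z ∈ Metric.ball (extChartAt (𝓡 n) p p) ε, F z = F (extChartAt (𝓡 n) p p) := by
    intro z hz
    refine Metric.isOpen_ball.is_const_of_fderiv_eq_zero (𝕜 := ℝ)
      (convex_ball _ _).isPreconnected ((hF.differentiableOn (by simp)).mono hball) ?_ hz
      (Metric.mem_ball_self hε)
    intro w hw
    exact fderiv_eq_zero_of_partialDeriv fun k =>
      hG.partialDeriv_sq_norm_eq_zero hXc (hpar p) (hball hw) k
  have hN : ∀ q ∈ (extChartAt (𝓡 n) p).source,
      g.inner q (X q) (X q) = F (extChartAt (𝓡 n) p q) := by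
    intro q hq
    have h := inner_field_eq_sum g X p ((extChartAt (𝓡 n) p).map_source hq)
    rwa [(extChartAt (𝓡 n) p).left_inv hq] at h
  have hcont : ∀ᶠ q in nhds p,
      extChartAt (𝓡 n) p q ∈ Metric.ball (extChartAt (𝓡 n) p p) ε :=
    (continuousAt_extChartAt p).eventually (Metric.ball_mem_nhds _ hε)
  filter_upwards [hcont, extChartAt_source_mem_nhds (I := 𝓡 n) p] with q hq hqs
  rw [hN q hqs, hN p (mem_extChartAt_source p), hconst _ hq]

/-- A parallel field that does not vanish identically on a component vanishes nowhere there. -/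
lemma IsParallel.ne_zero (hX : IsSmoothVectorField X) (hpar : IsParallel g X) {p q : M}
    (hq : q ∈ connectedComponent p) (hXq : X q ≠ 0) : X p ≠ 0 := by
  intro h0
  have h := (hpar.isLocallyConstant hX).apply_eq_of_isPreconnected
    isPreconnected_connectedComponent hq (mem_connectedComponent (x := p))
  have hpos := g.pos q _ hXq
  simp only [h0, map_zero] at h
  exact hpos.ne' h

lemma IsParallel.isCurvatureNull (hX : IsSmoothVectorField X) (hpar : IsParallel g X) (p : M) :
    IsCurvatureNull g p (X p) := by
  intro i j k
  simp only [← fieldInChart_self]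
  exact (isMetricOn_metricInChart g p).sum_riemann_mul_eq_zero (contDiffOn_fieldInChart hX p)
    (hpar p) (mem_extChartAt_target p) i j k

end ParallelVector

/-! ### Conformality as an equivalence relation -/

section ConformalClass

variable {n : ℕ} {M : Type*} [TopologicalSpace M] [ChartedSpace (EuclideanSpace ℝ (Fin n)) M]
  [IsManifold (𝓡 n) ∞ M] {g g' g'' : SmoothMetric n M}

lemma IsConformalTo.symm (h : IsConformalTo g g') : IsConformalTo g' g := by
  obtain ⟨f, hf, hg⟩ := h
  refine ⟨fun p => - f p, hf.neg, fun p v w => ?_⟩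
  rw [hg, ← mul_assoc, ← Real.exp_add]
  simp

lemma IsConformalTo.trans (h : IsConformalTo g g') (h' : IsConformalTo g' g'') :
    IsConformalTo g g'' := by
  obtain ⟨f, hf, hg⟩ := h
  obtain ⟨f', hf', hg'⟩ := h'
  refine ⟨fun p => f' p + f p, hf'.add hf, fun p v w => ?_⟩
  rw [hg', hg, ← mul_assoc, ← Real.exp_add, mul_add]

end ConformalClass

/-! ### The invariant flag and simple eigenvectors -/

section Eigenvectors

variable {n : ℕ} {M : Type*} [TopologicalSpace M] [ChartedSpace (EuclideanSpace ℝ (Fin n)) M]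
  [IsManifold (𝓡 n) ∞ M] {g : SmoothMetric n M} {p : M} {v : TangentSpace (𝓡 n) p}

lemma IsCurvatureNull.mapsTo_flag (hv : IsCurvatureNull g p v) :
    Set.MapsTo (weylOperator g p) (flag g p v) (flag g p v) := by
  rintro _ ⟨w, hw, rfl⟩
  exact ⟨weylEndomorphism g p w, hv.inner_weylEndomorphism hw, hv.weylOperator_wedge w⟩

lemma smul_mem_flag {b : Bivector n p} (c : ℝ) (hb : b ∈ flag g p v) : c • b ∈ flag g p v := by
  obtain ⟨w, hw, rfl⟩ := hb
  exact ⟨c • w, by rw [map_smul, hw, smul_zero], by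
    rw [← wedgeHom_apply, ← wedgeHom_apply, map_smul]⟩

/-- Wedging with v intertwines Φ on v^⊥ with W. It is injective there because a multiple of v
orthogonal to v is zero, so an eigenbasis of Φ on the hyperplane v^⊥ is carried to independent
eigenvectors. -/
lemma IsCurvatureNull.exists_eigenvectors (hv : IsCurvatureNull g p v) (hv0 : v ≠ 0) :
    ∃ b : Fin (n - 1) → Bivector n p, LinearIndependent ℝ b ∧
      ∀ i, IsSimpleBivector (b i) ∧ ∃ μ : ℝ, weylOperator g p (b i) = μ • b i := by
  let gv : Module.Dual ℝ (TangentSpace (𝓡 n) p) := (g.inner p v).toLinearMap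
  have hgv : ∀ w, gv w = g.inner p v w := fun w => rfl
  have hgv0 : gv ≠ 0 := by
    intro h
    exact (g.pos p v hv0).ne' (congrArg (fun L => L v) h)
  have : FiniteDimensional ℝ (TangentSpace (𝓡 n) p) :=
    inferInstanceAs (FiniteDimensional ℝ (EuclideanSpace ℝ (Fin n)))
  have hdim : Module.finrank ℝ (TangentSpace (𝓡 n) p) = n :=
    finrank_euclideanSpace_fin (𝕜 := ℝ) (n := n)
  have hrank : Module.finrank ℝ (LinearMap.ker gv) = n - 1 := by
    have := Module.Dual.finrank_ker_add_one_of_ne_zero hgv0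
    omega
  let B : LinearMap.ker gv →ₗ[ℝ] LinearMap.ker gv →ₗ[ℝ] ℝ :=
    LinearMap.mk₂ ℝ (fun x y => g.inner p x.1 y.1) (by simp) (by simp) (by simp) (by simp)
  let A : LinearMap.ker gv →ₗ[ℝ] LinearMap.ker gv :=
    (weylEndomorphism g p).restrict fun w hw => hv.inner_weylEndomorphism hw
  obtain ⟨b, hb, heig⟩ := exists_linearIndependent_eigenvectors B (fun x y => g.symm p _ _)
    (fun x hx => g.pos p _ fun h => hx (Subtype.ext h)) A
    (fun x y => inner_weylEndomorphism_comm g p x.1 y.1) hrank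
  have hker : LinearMap.ker ((wedgeHom p v).comp (LinearMap.ker gv).subtype) = ⊥ := by
    rw [LinearMap.ker_eq_bot']
    rintro ⟨w, hw⟩ hvw
    obtain ⟨c, rfl⟩ := exists_eq_smul_of_wedge_eq_zero hv0 hvw
    have hc : c * g.inner p v v = 0 := by
      have h := LinearMap.mem_ker.mp hw
      rwa [map_smul, smul_eq_mul, hgv] at h
    have hc0 : c = 0 := (mul_eq_zero.mp hc).resolve_right (g.pos p v hv0).ne'
    ext1
    simp [hc0]
  refine ⟨_, hb.map' _ hker, fun i => ⟨⟨v, (b i).1, rfl⟩, ?_⟩⟩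
  obtain ⟨μ, hμ⟩ := heig i
  refine ⟨μ, ?_⟩
  have h2 : weylEndomorphism g p (b i).1 = μ • (b i).1 := congrArg Subtype.val hμ
  change weylOperator g p (wedge v (b i).1) = μ • wedgeHom p v (b i).1
  rw [hv.weylOperator_wedge, h2, ← map_smul]
  rfl

end Eigenvectors

end ConformalWeyl

end

theorem theorem1p3 {n : ℕ} (hn : 4 ≤ n) {M : Type*} [TopologicalSpace M]
    [ChartedSpace (EuclideanSpace ℝ (Fin n)) M] [IsManifold (𝓡 n) ∞ M]
    (g : ConformalWeyl.SmoothMetric n M)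
    (h : ∃ g' : ConformalWeyl.SmoothMetric n M,
      ConformalWeyl.IsConformalTo g g' ∧ ConformalWeyl.AdmitsParallelField g') (p : M) :
    (∃ v : TangentSpace (𝓡 n) p, v ≠ 0 ∧
      ∀ g' : ConformalWeyl.SmoothMetric n M, ConformalWeyl.IsConformalTo g g' →
        Set.MapsTo (ConformalWeyl.weylOperator g' p)
          (ConformalWeyl.flag g' p v) (ConformalWeyl.flag g' p v)) ∧
    ∀ g' : ConformalWeyl.SmoothMetric n M, ConformalWeyl.IsConformalTo g g' →
      ∃ b : Fin (n - 1) → ConformalWeyl.Bivector n p, LinearIndependent ℝ b ∧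
        ∀ i, ConformalWeyl.IsSimpleBivector (b i) ∧
          ∃ μ : ℝ, (ConformalWeyl.weylOperator g' p).HasEigenvector μ (b i) := by
  obtain ⟨g₀, hg₀, X, hX, hpar, hXne⟩ := h
  obtain ⟨q, hq, hXq⟩ := hXne p
  have hne : X p ≠ 0 := hpar.ne_zero hX hq hXq
  have hnull := hpar.isCurvatureNull hX p
  have hconf : ∀ g' : ConformalWeyl.SmoothMetric n M, ConformalWeyl.IsConformalTo g g' →
      (∃ c : ℝ, ConformalWeyl.weylOperator g' p = c • ConformalWeyl.weylOperator g₀ p) ∧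
        ConformalWeyl.flag g' p (X p) = ConformalWeyl.flag g₀ p (X p) := by
    intro g' hg'
    -- Everything is compared with g₀, the metric for which `X` is parallel.
    obtain ⟨f, hf, hgg'⟩ := hg₀.symm.trans hg'
    refine ⟨ConformalWeyl.weylOperator_conformal (by omega) hf hgg' p, ?_⟩
    ext b
    refine exists_congr fun w => and_congr_left fun _ => ?_
    rw [hgg', mul_eq_zero]
    exact or_iff_right (Real.exp_pos _).ne'
  refine ⟨⟨X p, hne, fun g' hg' => ?_⟩, fun g' hg' => ?_⟩
  · obtain ⟨⟨c, hc⟩, hflag⟩ := hconf g' hg'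
    rw [hflag, hc]
    exact fun b hb => ConformalWeyl.smul_mem_flag c (hnull.mapsTo_flag hb)
  · obtain ⟨⟨c, hc⟩, -⟩ := hconf g' hg'
    obtain ⟨b, hb, heig⟩ := hnull.exists_eigenvectors hne
    refine ⟨b, hb, fun i => ⟨(heig i).1, ?_⟩⟩
    obtain ⟨μ, hμ⟩ := (heig i).2
    -- The eigenvectors of g₀ are reused, with eigenvalues rescaled by c; linear independence makes
    -- them non-zero.
    refine ⟨c * μ, Module.End.mem_eigenspace_iff.mpr ?_, hb.ne_zero i⟩
    rw [hc, LinearMap.smul_apply, hμ, smul_smul]
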